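/- Let $p$ be an odd prime, let $V$ be an $n$-dimensional vector space over $\mathbb{F}_p$ with a non-degenerate symmetric bilinear form $\langle\cdot,\cdot\rangle$, and let $\xi=e^{2\pi i/p}$. For $f:V\to\mathbb{F}_p$ put $W_f(\alpha)=\sum_{x\in V}\xi^{f(x)-\langle\alpha,x\rangle}$. For an integer $0\le s\le n$, the function $f$ is called $s$-plateaued if $|W_f(\alpha)|\in\{0,p^{(n+s)/2}\}$ for all $\alpha\in V$; then $S=\{\alpha: |W_f(\alpha)|=p^{(n+s)/2}\}$ is its Walsh support. Let $\mu=1$ if $p^{n+s}\equiv1\pmod 4$ and $\mu=\sqrt{-1}$ if $p^{n+s}\equiv3\pmod 4$. For each $\alpha\in S$ there are a unique sign $\epsilon_\alpha\in\{1,-1\}$ and a unique $f^*(\alpha)\in\mathbb{F}_p$ with $W_f(\alpha)=\epsilon_\alpha\,\mu\,p^{(n+s)/2}\,\xi^{f^*(\alpha)}$; the function $f^*:S\to\mathbb{F}_p$ is the dual of $f$. Put $B_+(f)=\{\alpha\in S:\epsilon_\alpha=1\}$ and $k=\#B_+(f)$. Put $W_{f^*}(\alpha)=\sum_{x\in S}\xi^{f^*(x)-\langle\alpha,x\rangle}$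 for $\alpha\in V$, and say that $f^*$ is bent relative to $S$ if $|W_{f^*}(\alpha)|=(\#S)^{1/2}$ for all $\alpha\in V$. Let $B_{\pm}(f^*)=\{\alpha\in V: W_{f^*}(\alpha)=\pm\mu\, p^{(n-s)/2}\,\xi^{f(-\alpha)}\}$. Let $f$ be an $s$-plateaued function such that: (1) $f(0)=0$; (2) $f^*$ is bent relative to $S$; (3) $aB_+(f^*)\subseteq B_+(f^*)$ and $aB_-(f^*)\subseteq B_-(f^*)$ for every $a\in\mathbb{F}_p^*$; (4) there are integers $t,t'$ with $2\le t,t'\le p-1$ and $\gcd(t-1,p-1)=\gcd(t'-1,p-1)=1$ such that $f(ax)=a^tf(x)$ for all $a\in\mathbb{F}_p^*$, $x\in B_+(f^*)$, and $f(ax)=a^{t'}f(x)$ for all $a\in\mathbb{F}_p^*$, $x\in B_-(f^*)$. (These conditions imply $0\in S$, so that $\epsilon_0$ is defined.) Assume $s\le n-4$ if $n+s$ is even, and $s\le n-3$ if $n+s$ is odd. Let $\widetilde D=\{x_1,\dots,x_m\}\subseteq V$, with $x_1,\dots,x_m$ distinct, be any set such that the sets $a\widetilde D$, $a\in\mathbb{F}_p^*$,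 form a partition of $\{x\in V\setminus\{0\}: f(x)=0\}$, let $\widetilde{\mathcal C}=\{(\langle a,x_1\rangle,\dots,\langle a,x_m\rangle):a\in V\}\subseteq\mathbb{F}_p^m$, and let $\widetilde{\mathcal C}^{\perp}=\{u\in\mathbb{F}_p^m: u\cdot c=0 \text{ for all } c\in\widetilde{\mathcal C}\}$ be its dual code, with minimum Hamming distance $d^{\perp}$. If $n+s$ is even, then $m=\frac{p^{n-1}+\epsilon_0(p-1)p^{(n+s)/2-1}-1}{p-1}$ and $\dim\widetilde{\mathcal C}^{\perp}=m-n$; moreover $d^{\perp}=4$ if $s=0$, $n=4$ and $k=0$, and $d^{\perp}=3$ otherwise. If $n+s$ is odd, then $m=\frac{p^{n-1}-1}{p-1}$ and $\dim\widetilde{\mathcal C}^{\perp}=m-n$; moreover $d^{\perp}=4$ if $s=0$ and $n=3$, and $d^{\perp}=3$ otherwise. -/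

import Mathlib

namespace PlateauedCode

section Functions

variable {p : ℕ} [Fact p.Prime] {V : Type*} [AddCommGroup V] [Module (ZMod p) V] [Fintype V]

/-- The Walsh transform of `f : V → 𝔽_p` at `α`, i.e. the sum over `x` of
`ξ ^ (f x - ⟨α, x⟩)`, where `ξ = exp (2 π i / p)` and `j ↦ ξ ^ j` is `ZMod.stdAddChar`.
The inner product is the bilinear form `B`. -/
noncomputable def walsh (B : LinearMap.BilinForm (ZMod p) V) (f : V → ZMod p) (α : V) : ℂ :=
  ∑ x : V, ZMod.stdAddChar (f x - B α x)

/-- `f` is `s`-plateaued: `0 ≤ s ≤ n` and every Walsh value has modulus `0` or `p ^ ((n + s) / 2)`,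
where `n` is the dimension of `V`. -/
def IsPlateaued (B : LinearMap.BilinForm (ZMod p) V) (f : V → ZMod p) (s : ℕ) : Prop :=
  s ≤ Module.finrank (ZMod p) V ∧
    ∀ α : V, ‖walsh B f α‖ = 0 ∨
      ‖walsh B f α‖ = √(p : ℝ) ^ (Module.finrank (ZMod p) V + s)

open scoped Classical in
/-- The Walsh support of an `s`-plateaued function. -/
noncomputable def walshSupport (B : LinearMap.BilinForm (ZMod p) V) (f : V → ZMod p) (s : ℕ) :
    Finset V :=
  Finset.univ.filter fun α =>
    ‖walsh B f α‖ = √(p : ℝ) ^ (Module.finrank (ZMod p) V + s)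

/-- `μ = 1` if `p ^ m ≡ 1 mod 4`, and `μ = i` otherwise (i.e. if `p ^ m ≡ 3 mod 4`, as `p` is
odd). It is used with `m = n + s`. -/
noncomputable def unit (p m : ℕ) : ℂ := if p ^ m % 4 = 1 then 1 else Complex.I

/-- The number `μ * p ^ ((n + s) / 2) * ξ ^ j`; up to sign, a non-zero Walsh value of an
`s`-plateaued function has this form. -/
noncomputable def walshValue (p n s : ℕ) [NeZero p] (j : ZMod p) : ℂ :=
  unit p (n + s) * ((√(p : ℝ) : ℝ) : ℂ) ^ (n + s) * ZMod.stdAddChar j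

/-- The dual `f*` of an `s`-plateaued function: for `α` in the Walsh support, `f* α` is the
(unique) `j` such that the Walsh value at `α` is `± μ * p ^ ((n + s) / 2) * ξ ^ j`.
Values outside the Walsh support are irrelevant and never used. -/
noncomputable def dual (B : LinearMap.BilinForm (ZMod p) V) (f : V → ZMod p) (s : ℕ) (α : V) :
    ZMod p :=
  Classical.epsilon fun j : ZMod p =>
    walsh B f α = walshValue p (Module.finrank (ZMod p) V) s j ∨
      walsh B f α = -walshValue p (Module.finrank (ZMod p) V) s j

open scoped Classical in
/-- `B₊(f)`. -/
noncomputable def bPlus (B : LinearMap.BilinForm (ZMod p) V) (f : V → ZMod p) (s : ℕ) :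
    Finset V :=
  (walshSupport B f s).filter fun α =>
    walsh B f α = walshValue p (Module.finrank (ZMod p) V) s (dual B f s α)

open scoped Classical in
/-- `B₋(f)`. -/
noncomputable def bMinus (B : LinearMap.BilinForm (ZMod p) V) (f : V → ZMod p) (s : ℕ) :
    Finset V :=
  (walshSupport B f s).filter fun α =>
    walsh B f α = -walshValue p (Module.finrank (ZMod p) V) s (dual B f s α)

open scoped Classical in
/-- `ε_α`: it is `1` on `B₊(f)` and `-1` on `B₋(f)` (and `0` outside the Walsh support). -/
noncomputable def eps (B : LinearMap.BilinForm (ZMod p) V) (f : V → ZMod p) (s : ℕ) (α : V) : ℤ :=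
  if α ∈ bPlus B f s then 1 else if α ∈ bMinus B f s then -1 else 0

/-- The Walsh transform of the dual `f*`, which is a function on the Walsh support of `f`. -/
noncomputable def walshDual (B : LinearMap.BilinForm (ZMod p) V) (f : V → ZMod p) (s : ℕ)
    (α : V) : ℂ :=
  ∑ x ∈ walshSupport B f s, ZMod.stdAddChar (dual B f s x - B α x)

/-- The dual `f*` is bent relative to the Walsh support of `f`. -/
def DualIsBent (B : LinearMap.BilinForm (ZMod p) V) (f : V → ZMod p) (s : ℕ) : Prop :=
  ∀ α : V, ‖walshDual B f s α‖ = √((walshSupport B f s).card : ℝ)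

/-- The number `μ * p ^ ((n - s) / 2) * ξ ^ j`, with `μ` determined by `p ^ (n + s)` mod `4`. -/
noncomputable def walshDualValue (p n s : ℕ) [NeZero p] (j : ZMod p) : ℂ :=
  unit p (n + s) * ((√(p : ℝ) : ℝ) : ℂ) ^ (n - s) * ZMod.stdAddChar j

/-- `B₊(f*)`. -/
def bPlusDual (B : LinearMap.BilinForm (ZMod p) V) (f : V → ZMod p) (s : ℕ) : Set V :=
  {α | walshDual B f s α = walshDualValue p (Module.finrank (ZMod p) V) s (f (-α))}

/-- `B₋(f*)`. -/
def bMinusDual (B : LinearMap.BilinForm (ZMod p) V) (f : V → ZMod p) (s : ℕ) : Set V :=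
  {α | walshDual B f s α = -walshDualValue p (Module.finrank (ZMod p) V) s (f (-α))}

/-- The class `𝓕` of `s`-plateaued functions. -/
structure ClassF (B : LinearMap.BilinForm (ZMod p) V) (f : V → ZMod p) (s : ℕ) : Prop where
  plateaued : IsPlateaued B f s
  map_zero : f 0 = 0
  dual_bent : DualIsBent B f s
  smul_mem_plus : ∀ (a : ZMod p) (x : V), a ≠ 0 → x ∈ bPlusDual B f s → a • x ∈ bPlusDual B f s
  smul_mem_minus : ∀ (a : ZMod p) (x : V), a ≠ 0 → x ∈ bMinusDual B f s → a • x ∈ bMinusDual B f s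
  form_plus : ∃ t : ℕ, 2 ≤ t ∧ t ≤ p - 1 ∧ Nat.gcd (t - 1) (p - 1) = 1 ∧
    ∀ (a : ZMod p) (x : V), a ≠ 0 → x ∈ bPlusDual B f s → f (a • x) = a ^ t * f x
  form_minus : ∃ t : ℕ, 2 ≤ t ∧ t ≤ p - 1 ∧ Nat.gcd (t - 1) (p - 1) = 1 ∧
    ∀ (a : ZMod p) (x : V), a ≠ 0 → x ∈ bMinusDual B f s → f (a • x) = a ^ t * f x

end Functions

section Codes

variable {p : ℕ}

/-- The sets `a • D`, for `a` a non-zero scalar, form a partition of `E`. -/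
def IsScalarTransversal {V : Type*} [AddCommGroup V] [Module (ZMod p) V] (D E : Set V) : Prop :=
  (⋃ a : (ZMod p)ˣ, (fun x : V => (a : ZMod p) • x) '' D) = E ∧
    ∀ a b : (ZMod p)ˣ, a ≠ b →
      Disjoint ((fun x : V => (a : ZMod p) • x) '' D) ((fun x : V => (b : ZMod p) • x) '' D)

/-- The defining-set code: all words `(⟨a, x₁⟩, …, ⟨a, x_m⟩)` with `a ∈ V`. -/
def definingSetCode {V : Type*} [AddCommGroup V] [Module (ZMod p) V]
    (B : LinearMap.BilinForm (ZMod p) V) {m : ℕ} (x : Fin m → V) :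
    Submodule (ZMod p) (Fin m → ZMod p) :=
  LinearMap.range (LinearMap.pi fun i => B.flip (x i))

/-- The dual code: all words `u` with `u ⬝ᵥ c = 0` for every codeword `c`. -/
def dualCode {m : ℕ} (C : Submodule (ZMod p) (Fin m → ZMod p)) :
    Submodule (ZMod p) (Fin m → ZMod p) where
  carrier := {u | ∀ c ∈ C, u ⬝ᵥ c = 0}
  add_mem' := fun hu hv c hc => by rw [add_dotProduct, hu c hc, hv c hc, add_zero]
  zero_mem' := fun c _ => zero_dotProduct c
  smul_mem' := fun a u hu c hc => by rw [smul_dotProduct, hu c hc, smul_zero]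

/-- `d` is the minimum Hamming distance of `C` (in particular `C` has two different codewords). -/
def HasMinDist {m : ℕ} (C : Submodule (ZMod p) (Fin m → ZMod p)) (d : ℕ) : Prop :=
  IsLeast {e : ℕ | ∃ u ∈ C, ∃ v ∈ C, u ≠ v ∧ hammingDist u v = e} d

end Codes

end PlateauedCode

/-! By nondegeneracy the words of the dual code are the linear relations among the points `x i`
(`mem_dualCode_iff`). These points are non-zero and pairwise independent, so the distance is at
least 3, and it is 3 exactly when the points do not form a cap. It remains to find `m`, to see that
the points span `V`, and to decide when they form a cap.

Point counts come from Walsh values. The only relation among the `p`-th roots of unity is that they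
sum to zero, so `W_f(α)` determines the number of solutions of `f x = ⟨α, x⟩`. Homogeneity with
`gcd(t - 1, p - 1) = 1` gives `y * f x = ⟨α, x⟩` the same number of solutions for all `y ≠ 0`, and
summing over `y` isolates the zeros of `f` on the hyperplane `α^⊥` (`ClassF.card_zeros_hyperplane`).
No hyperplane holds all the points, so they span.

That `0 ∈ S`, `f*(0) = 0` and `V = B₊(f*) ∪ B₋(f*)` follows from parity: modulo 2 the signs `ε_α`
disappear, and the coefficients of `± μ √p ^ m ξ ^ j` single out `j`.

A cap has at most `p ^ (n - 2) + 1` points (`IsCap.card_le`). Comparison with `m` leaves only `s =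
0`, `n = 3`, and `s = 0`, `n = 4`, `ε_0 = -1`. In the former case every line carries at most two
points, so there is a cap. In the latter a cap is an ovoid: each plane with two of its points has `p
+ 1` of them, and this holds exactly when no `ε_α` is `1`. For these caps four points in a
three-dimensional subspace give distance 4. -/

namespace PlateauedCode

/-! ### Arithmetic of the `p`-th cyclotomic field. -/

section Cyclotomic

open NumberField Polynomial

theorem stdAddChar_natCast {p : ℕ} [NeZero p] (k : ℕ) :
    (ZMod.stdAddChar (k : ZMod p) : ℂ) = ZMod.stdAddChar (1 : ZMod p) ^ k := by
  rw [← AddChar.map_nsmul_eq_pow]; simp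

theorem isPrimitiveRoot_stdAddChar_one (p : ℕ) [NeZero p] :
    IsPrimitiveRoot (ZMod.stdAddChar (1 : ZMod p) : ℂ) p := by
  refine (IsPrimitiveRoot.iff_def _ _).2 ⟨?_, fun l hl => ?_⟩
  · rw [← stdAddChar_natCast]; simp
  · rw [← stdAddChar_natCast, ← (ZMod.stdAddChar (N := p)).map_zero_eq_one,
      ZMod.injective_stdAddChar.eq_iff] at hl
    exact (ZMod.natCast_eq_zero_iff _ _).1 hl

/-- A rational-integer combination of all `p`-th roots of unity vanishes only if all of its
coefficients agree. -/
theorem coeff_eq_of_sum_stdAddChar_eq_zero {p : ℕ} [hp : Fact p.Prime] (c : ZMod p → ℤ)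
    (h : ∑ i, (c i : ℂ) * ZMod.stdAddChar i = 0) (i j : ZMod p) : c i = c j := by
  set ξ : ℂ := ZMod.stdAddChar (1 : ZMod p) with hξ
  have hpow : ∀ k : ℕ, (ZMod.stdAddChar (k : ZMod p) : ℂ) = ξ ^ k := stdAddChar_natCast
  have hprim : IsPrimitiveRoot ξ p := isPrimitiveRoot_stdAddChar_one p
  have hsum : ∀ F : ZMod p → ℂ, ∑ i, F i = ∑ k ∈ Finset.range p, F (k : ZMod p) := fun F => by
    refine (Finset.sum_bij (fun (k : ℕ) _ => (k : ZMod p)) (fun _ _ => Finset.mem_univ _) ?_ ?_ ?_).symm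
    · intro a ha b hb hab
      have := congrArg ZMod.val hab
      rwa [ZMod.val_natCast_of_lt (Finset.mem_range.1 ha),
        ZMod.val_natCast_of_lt (Finset.mem_range.1 hb)] at this
    · exact fun b _ => ⟨b.val, Finset.mem_range.2 (ZMod.val_lt b), by simp⟩
    · simp
  -- Subtracting the last coefficient from all of them removes the term of degree `p - 1`, so the
  -- degree drops below that of the cyclotomic polynomial, the minimal polynomial of `ξ`.
  set e : ℤ := c ((p - 1 : ℕ) : ZMod p) with he
  set P : ℤ[X] := ∑ k ∈ Finset.range p, C (c (k : ZMod p) - e) * X ^ k with hP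
  have hcoeff : ∀ k < p, P.coeff k = c (k : ZMod p) - e := fun k hk => by
    simp only [hP, finsetSum_coeff, coeff_C_mul, coeff_X_pow]
    simp [hk]
  have hdeg : P.degree < (p - 1 : ℕ) := by
    rw [degree_lt_iff_coeff_zero]
    intro k hk
    rcases hk.eq_or_lt with rfl | hk
    · rw [hcoeff _ (by have := hp.out.pos; omega), he, sub_self]
    · have : ∀ l ∈ Finset.range p, k ≠ l := fun l hl => by
        have := Finset.mem_range.1 hl; omega
      simp only [hP, finsetSum_coeff, coeff_C_mul, coeff_X_pow]
      exact Finset.sum_eq_zero fun l hl => by simp [this l hl]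
  have hroot : aeval ξ P = 0 := by
    have h1 : ∑ k ∈ Finset.range p, ξ ^ k = 0 := hprim.geom_sum_eq_zero hp.out.one_lt
    rw [hsum] at h
    simp only [hpow] at h
    have : aeval ξ P = ∑ k ∈ Finset.range p, ((c (k : ZMod p) : ℂ) * ξ ^ k) -
        e * ∑ k ∈ Finset.range p, ξ ^ k := by
      simp [hP, Finset.mul_sum, sub_mul]
    rw [this, h, h1]; simp
  have hP0 : P = 0 := by
    by_contra hne
    have hdvd := minpoly.isIntegrallyClosed_dvd (hprim.isIntegral hp.out.pos) hroot
    rw [← cyclotomic_eq_minpoly hprim hp.out.pos] at hdvd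
    have := degree_le_of_dvd hdvd hne
    rw [degree_cyclotomic, Nat.totient_prime hp.out] at this
    exact absurd (this.trans_lt hdeg) (lt_irrefl _)
  have hall : ∀ i : ZMod p, c i = e := fun i => by
    have := hcoeff i.val (ZMod.val_lt i)
    rw [hP0, coeff_zero, ZMod.natCast_zmod_val] at this
    omega
  rw [hall, hall]

/-- Two algebraic integers of the `p`-th cyclotomic field, both of absolute value
`√p ^ m` at every complex place, differ by a root of unity. -/
theorem eq_mul_root_of_mul_conj_eq {p : ℕ} [hp : Fact p.Prime] (hp2 : p ≠ 2)
    {K : Type*} [Field K] [NumberField K] [IsCMField K] [IsCyclotomicExtension {p} ℚ K]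
    {ζ : K} (hζ : IsPrimitiveRoot ζ p) (m : ℕ) (w v : 𝓞 K)
    (hw : (w : K) * IsCMField.complexConj K w = p ^ m)
    (hv : (v : K) * IsCMField.complexConj K v = p ^ m) :
    ∃ r : ℕ, (w : K) = v * ζ ^ r ∨ (w : K) = -(v * ζ ^ r) := by
  set π : 𝓞 K := hζ.toInteger - 1 with hπ
  have hprime : Prime π := hζ.zeta_sub_one_prime'
  set σ := IsCMField.ringOfIntegersComplexConj K
  have hσprim : IsPrimitiveRoot (IsCMField.complexConj K ζ) p :=
    hζ.map_of_injective (IsCMField.complexConj K).injective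
  have hσπ : Associated π (σ π) := by
    have h1 := IsCyclotomicExtension.Rat.associated_sub_one_of_isPrimitiveRoot p hζ hσprim
    have h2 : σ π = hσprim.toInteger - 1 := by
      apply RingOfIntegers.ext
      simp only [hπ, σ, IsCMField.coe_ringOfIntegersComplexConj, map_sub, map_one]
      rfl
    rwa [h2]
  have hpπ := IsCyclotomicExtension.Rat.associated_zeta_sub_one_pow_prime p hζ
  -- `p` is totally ramified: it is associated to `π ^ (p - 1)`, and conjugation fixes `π` up to a
  -- unit. Hence `w` is a power of `π` up to a unit, with an exponent that depends on `m` only.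
  have key : ∀ w : 𝓞 K, (w : K) * IsCMField.complexConj K w = p ^ m →
      ∃ a, 2 * a = (p - 1) * m ∧ Associated w (π ^ a) := by
    intro w hw
    have hw' : w * σ w = p ^ m := by
      apply RingOfIntegers.ext
      simpa [σ] using hw
    have h1 : Associated (w * σ w) (π ^ ((p - 1) * m)) := by
      rw [hw', pow_mul]; exact (hpπ.pow_pow).symm
    have hdvd : w ∣ π ^ ((p - 1) * m) := (Dvd.intro _ rfl).trans h1.dvd
    obtain ⟨a, -, ha⟩ := (dvd_prime_pow hprime _).1 hdvd
    refine ⟨a, ?_, ha⟩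
    have h2 : Associated (σ w) (π ^ a) := by
      have := ha.map (σ : 𝓞 K →* 𝓞 K)
      simp only [MonoidHom.coe_coe, map_pow] at this
      exact this.trans (hσπ.symm.pow_pow)
    have h3 := (ha.mul_mul h2).symm.trans h1
    rw [← pow_add] at h3
    have h4 := (pow_dvd_pow_iff hprime.ne_zero hprime.not_isUnit).1 h3.dvd
    have h5 := (pow_dvd_pow_iff hprime.ne_zero hprime.not_isUnit).1 h3.symm.dvd
    omega
  obtain ⟨a, ha, hwa⟩ := key w hw
  obtain ⟨b, hb, hvb⟩ := key v hv
  obtain rfl : a = b := by omega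
  obtain ⟨u, hu⟩ := hvb.trans hwa.symm
  have hnorm : ∀ (φ : K →+* ℂ) (w : 𝓞 K), (w : K) * IsCMField.complexConj K w = p ^ m →
      ‖φ w‖ ^ 2 = (p : ℝ) ^ m := by
    intro φ w hw
    have := congrArg φ hw
    rw [map_mul, IsCMField.complexEmbedding_complexConj, Complex.mul_conj, Complex.normSq_eq_norm_sq]
      at this
    simp only [map_pow, map_natCast] at this
    exact_mod_cast this
  -- Kronecker's theorem: conjugation commutes with every complex embedding of a CM field, so the
  -- unit `u` has absolute value 1 everywhere and is a root of unity.
  have hfin : IsOfFinOrder (u : 𝓞 K).1 := by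
    have h1 : ∀ φ : K →+* ℂ, ‖φ (u : 𝓞 K)‖ = 1 := by
      intro φ
      have h2 := hnorm φ w hw
      have h3 := hnorm φ v hv
      have h4 : φ w = φ v * φ (u : 𝓞 K) := by rw [← map_mul, ← hu]; simp
      rw [h4, norm_mul, mul_pow, h3] at h2
      have hpm : (p : ℝ) ^ m ≠ 0 := pow_ne_zero _ (Nat.cast_ne_zero.2 hp.out.ne_zero)
      have h5 : ‖φ (u : 𝓞 K)‖ ^ 2 = 1 := by
        apply mul_left_cancel₀ hpm; rw [h2, mul_one]
      exact (pow_eq_one_iff_of_nonneg (norm_nonneg _) two_ne_zero).1 h5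
    obtain ⟨n, hn, hx⟩ := Embeddings.pow_eq_one_of_norm_eq_one K ℂ
      (RingOfIntegers.isIntegral_coe (u : 𝓞 K)) h1
    exact isOfFinOrder_iff_pow_eq_one.2 ⟨n, hn, hx⟩
  obtain ⟨r, -, hr⟩ := hζ.exists_pow_or_neg_mul_pow_of_isOfFinOrder
    (hp.out.odd_of_ne_two hp2) hfin
  have hw' : (w : K) = v * (u : 𝓞 K) := by rw [← hu]; simp
  refine ⟨r, ?_⟩
  rw [hw']
  exact hr.imp (fun h => congrArg (_ * ·) h) fun h => (congrArg (_ * ·) h).trans (by ring)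

/-- The sums live in `ℚ(ξ)`, a CM field as `p > 2`. One absolute value suffices: `w * conj w = p ^
m` is an identity in the field, so it may be checked under a single embedding. -/
theorem eq_or_eq_neg_mul_stdAddChar {p : ℕ} [hp : Fact p.Prime] (hp2 : p ≠ 2) (m : ℕ)
    (c d : ZMod p → ℤ) (hc : ‖∑ i, (c i : ℂ) * ZMod.stdAddChar i‖ ^ 2 = (p : ℝ) ^ m)
    (hd : ‖∑ i, (d i : ℂ) * ZMod.stdAddChar i‖ ^ 2 = (p : ℝ) ^ m) :
    ∃ j : ZMod p,
      ∑ i, (c i : ℂ) * ZMod.stdAddChar i = (∑ i, (d i : ℂ) * ZMod.stdAddChar i) *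
        ZMod.stdAddChar j ∨
      ∑ i, (c i : ℂ) * ZMod.stdAddChar i = -((∑ i, (d i : ℂ) * ZMod.stdAddChar i) *
        ZMod.stdAddChar j) := by
  set ξ : ℂ := ZMod.stdAddChar (1 : ZMod p) with hξ
  have hprim : IsPrimitiveRoot ξ p := isPrimitiveRoot_stdAddChar_one p
  have hcyc : IsCyclotomicExtension {p} ℚ (IntermediateField.adjoin ℚ {ξ}) := by
    change IsCyclotomicExtension {p} ℚ (IntermediateField.adjoin ℚ {ξ}).toSubalgebra
    rw [IntermediateField.adjoin_simple_toSubalgebra_of_isAlgebraic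
      ((hprim.isIntegral hp.out.pos).tower_top.isAlgebraic)]
    exact hprim.adjoin_isCyclotomicExtension ℚ
  have hNF : NumberField (IntermediateField.adjoin ℚ {ξ}) :=
    IsCyclotomicExtension.numberField {p} ℚ _
  have hCM : IsCMField (IntermediateField.adjoin ℚ {ξ}) :=
    IsCyclotomicExtension.Rat.isCMField (S := {p}) _
      ⟨p, rfl, lt_of_le_of_ne hp.out.two_le hp2.symm⟩
  obtain ⟨φ, ζ, hζ, hφ⟩ : ∃ (φ : IntermediateField.adjoin ℚ {ξ} →+* ℂ)
      (ζ : IntermediateField.adjoin ℚ {ξ}), IsPrimitiveRoot ζ p ∧ φ ζ = ξ :=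
    ⟨(IntermediateField.adjoin ℚ {ξ}).val, IntermediateField.AdjoinSimple.gen ℚ ξ,
      IsPrimitiveRoot.of_map_of_injective (f := (IntermediateField.adjoin ℚ {ξ}).val)
        (by simpa using hprim) Subtype.val_injective, by simp⟩
  have hpow : ∀ k : ZMod p, φ (ζ ^ k.val) = ZMod.stdAddChar k := fun k => by
    rw [map_pow, hφ, ← AddChar.map_nsmul_eq_pow]; simp
  set el : (ZMod p → ℤ) → 𝓞 (IntermediateField.adjoin ℚ {ξ}) :=
    fun c => ∑ i, (c i : 𝓞 (IntermediateField.adjoin ℚ {ξ})) * hζ.toInteger ^ i.val with hel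
  have hφel : ∀ c, φ (el c) = ∑ i, (c i : ℂ) * ZMod.stdAddChar i := fun c => by
    have h1 : (algebraMap (𝓞 (IntermediateField.adjoin ℚ {ξ})) (IntermediateField.adjoin ℚ {ξ}))
        hζ.toInteger = ζ := rfl
    simp [hel, ← hpow, h1]
  have hmul : ∀ c : ZMod p → ℤ, ‖∑ i, (c i : ℂ) * ZMod.stdAddChar i‖ ^ 2 = (p : ℝ) ^ m →
      (el c : IntermediateField.adjoin ℚ {ξ}) *
        IsCMField.complexConj _ (el c : IntermediateField.adjoin ℚ {ξ}) = p ^ m := by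
    intro c hc
    apply φ.injective
    rw [map_mul, IsCMField.complexEmbedding_complexConj, Complex.mul_conj,
      Complex.normSq_eq_norm_sq, hφel, hc]
    simp
  obtain ⟨r, hr⟩ := eq_mul_root_of_mul_conj_eq hp2 hζ m (el c) (el d) (hmul c hc) (hmul d hd)
  refine ⟨(r : ZMod p), ?_⟩
  have hr' : φ (ζ ^ r) = ZMod.stdAddChar (r : ZMod p) := by
    rw [map_pow, hφ, ← AddChar.map_nsmul_eq_pow]; simp
  rw [← hφel, ← hφel, ← hr', ← map_mul, ← map_neg]
  exact hr.imp (congrArg φ) (congrArg φ)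

end Cyclotomic

/-! ### The numbers `μ √p ^ m` as integer combinations of roots of unity. -/

section GaussSum

theorem pow_mod_four_eq_one_iff_of_odd {p m : ℕ} (hp : Odd p) (hm : Odd m) :
    p ^ m % 4 = 1 ↔ p % 4 = 1 := by
  obtain ⟨k, rfl⟩ := hm
  have h2 : p ^ 2 % 4 = 1 := by
    obtain ⟨l, rfl⟩ := hp
    have : (2 * l + 1) ^ 2 = 4 * (l ^ 2 + l) + 1 := by ring
    omega
  have h3 : (p ^ 2) ^ k % 4 = 1 := by rw [Nat.pow_mod, h2]; simp
  rw [pow_succ, pow_mul, Nat.mul_mod, h3, one_mul, Nat.mod_mod]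

theorem pow_mod_four_eq_one_of_even {p m : ℕ} (hp : Odd p) (hm : Even m) : p ^ m % 4 = 1 := by
  obtain ⟨k, rfl⟩ := hm
  have h2 : p ^ 2 % 4 = 1 := by
    obtain ⟨l, rfl⟩ := hp
    have : (2 * l + 1) ^ 2 = 4 * (l ^ 2 + l) + 1 := by ring
    omega
  rw [← two_mul, pow_mul, Nat.pow_mod, h2]; simp

/-- Odd squares are 1 modulo 4, so only the parity of the exponent matters. This lets the `μ` of `n
+ s` accompany `√p ^ (n - s)`. -/
theorem unit_congr {p a b : ℕ} (hp : Odd p) (h : Even a ↔ Even b) : unit p a = unit p b := by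
  unfold unit
  rcases Nat.even_or_odd a with ha | ha
  · rw [if_pos (pow_mod_four_eq_one_of_even hp ha),
      if_pos (pow_mod_four_eq_one_of_even hp (h.1 ha))]
  · have hb : Odd b := by rw [← Nat.not_even_iff_odd, ← h]; exact Nat.not_even_iff_odd.2 ha
    simp only [pow_mod_four_eq_one_iff_of_odd hp ha, pow_mod_four_eq_one_iff_of_odd hp hb]

theorem norm_unit (p m : ℕ) : ‖unit p m‖ = 1 := by
  unfold unit; split_ifs <;> simp

theorem sqrt_pow_two_mul (p h : ℕ) : ((√(p : ℝ) : ℝ) : ℂ) ^ (2 * h) = p ^ h := by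
  rw [pow_mul, ← Complex.ofReal_pow, Real.sq_sqrt (Nat.cast_nonneg p), Complex.ofReal_natCast]

theorem unit_mul_sqrt_pow_of_even {p m : ℕ} (hp : Odd p) (hm : Even m) :
    unit p m * ((√(p : ℝ) : ℝ) : ℂ) ^ m = ((p ^ (m / 2) : ℤ) : ℂ) := by
  rw [unit, if_pos (pow_mod_four_eq_one_of_even hp hm), one_mul]
  conv_lhs => rw [← Nat.two_mul_div_two_of_even hm]
  rw [sqrt_pow_two_mul]; push_cast; rfl

/-- The quadratic Gauss sum and `μ √p` have the same square `χ(-1) p`. The sign `δ` is left open: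
neither the parity arguments nor the point counts depend on it. -/
theorem exists_unit_mul_sqrt_pow_of_odd {p : ℕ} [hp : Fact p.Prime] (hp2 : p ≠ 2) {m : ℕ}
    (hm : Odd m) :
    ∃ δ : ℤ, (δ = 1 ∨ δ = -1) ∧ unit p m * ((√(p : ℝ) : ℝ) : ℂ) ^ m =
      ∑ i : ZMod p, ((δ * p ^ (m / 2) * quadraticChar (ZMod p) i : ℤ) : ℂ) *
        ZMod.stdAddChar i := by
  have hodd : Odd p := hp.out.odd_of_ne_two hp2
  have hchar : ringChar (ZMod p) ≠ 2 := by rwa [ZMod.ringChar_zmod_n]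
  set g : ℂ := gaussSum ((quadraticChar (ZMod p)).ringHomComp (Int.castRingHom ℂ))
    ZMod.stdAddChar with hg
  have hinj : Function.Injective (Int.castRingHom ℂ) := Int.cast_injective
  have hsq : g ^ 2 = quadraticChar (ZMod p) (-1) * p := by
    rw [hg, gaussSum_sq ((MulChar.ringHomComp_ne_one_iff hinj).2 (quadraticChar_ne_one hchar))
      ((quadraticChar_isQuadratic _).comp _) (ZMod.isPrimitive_stdAddChar p), ZMod.card]
    rfl
  have hu : (unit p 1 * ((√(p : ℝ) : ℝ) : ℂ)) ^ 2 = g ^ 2 := by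
    have h1 := sqrt_pow_two_mul p 1
    rw [hsq, mul_pow, ← mul_one 2, h1, quadraticChar_neg_one hchar, ZMod.card, unit, pow_one]
    have h4 : p % 4 = 1 ∨ p % 4 = 3 := by
      obtain ⟨l, rfl⟩ := hodd; omega
    rcases h4 with h4 | h4
    · rw [if_pos h4, ZMod.χ₄_nat_one_mod_four h4]; simp
    · rw [if_neg (by omega), ZMod.χ₄_nat_three_mod_four h4]; simp
  have hgsum : g = ∑ i : ZMod p, ((quadraticChar (ZMod p) i : ℤ) : ℂ) * ZMod.stdAddChar i := rfl
  have hmain : unit p m * ((√(p : ℝ) : ℝ) : ℂ) ^ m =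
      p ^ (m / 2) * (unit p 1 * ((√(p : ℝ) : ℝ) : ℂ)) := by
    rw [unit_congr hodd (a := m) (b := 1) (by simpa using hm)]
    conv_lhs => rw [← Nat.two_mul_div_two_add_one_of_odd hm, pow_succ, sqrt_pow_two_mul]
    ring
  rcases sq_eq_sq_iff_eq_or_eq_neg.1 hu with h | h
  · refine ⟨1, Or.inl rfl, ?_⟩
    rw [hmain, h, hgsum, Finset.mul_sum]
    exact Finset.sum_congr rfl fun i _ => by push_cast; ring
  · refine ⟨-1, Or.inr rfl, ?_⟩
    rw [hmain, h, hgsum, ← Finset.sum_neg_distrib, Finset.mul_sum]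
    exact Finset.sum_congr rfl fun i _ => by push_cast; ring

/-- `μ * √p ^ m` is an integer combination of `p`-th roots of unity, and modulo `2` its
coefficients are those of `1` up to a constant. -/
theorem exists_coeff_unit_mul_sqrt_pow {p : ℕ} [hp : Fact p.Prime] (hp2 : p ≠ 2) (m : ℕ) :
    ∃ c : ZMod p → ℤ, unit p m * ((√(p : ℝ) : ℝ) : ℂ) ^ m =
        ∑ i : ZMod p, (c i : ℂ) * ZMod.stdAddChar i ∧
      ∃ e : ZMod 2, ∀ i, (c i : ZMod 2) = e + if i = 0 then 1 else 0 := by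
  have hodd : Odd p := hp.out.odd_of_ne_two hp2
  have hp1 : ((p : ℤ) : ZMod 2) = 1 := by
    obtain ⟨l, rfl⟩ := hodd
    push_cast
    rw [show (2 : ZMod 2) = 0 from rfl]; simp
  rcases Nat.even_or_odd m with hm | hm
  · refine ⟨fun i => if i = 0 then p ^ (m / 2) else 0, ?_, 0, fun i => ?_⟩
    · rw [unit_mul_sqrt_pow_of_even hodd hm, Finset.sum_eq_single 0]
      · simp
      · intro i _ hi; simp [hi]
      · simp
    · beta_reduce
      split_ifs
      · rw [Int.cast_pow, hp1]; simp
      · simp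
  · obtain ⟨δ, hδ, h⟩ := exists_unit_mul_sqrt_pow_of_odd hp2 hm
    -- The quadratic character is odd away from 0 and vanishes at 0; modulo 2 it is `1 + [i = 0]`.
    refine ⟨_, h, 1, fun i => ?_⟩
    rw [Int.cast_mul, Int.cast_mul, Int.cast_pow, hp1]
    have hδ' : (δ : ZMod 2) = 1 := by rcases hδ with rfl | rfl <;> rfl
    rw [hδ']
    split_ifs with hi
    · subst hi; simp; rfl
    · rcases quadraticChar_dichotomy hi with h | h <;> rw [h] <;> simp

theorem norm_unit_mul_sqrt_pow_sq (p m k : ℕ) :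
    ‖unit p k * ((√(p : ℝ) : ℝ) : ℂ) ^ m‖ ^ 2 = (p : ℝ) ^ m := by
  rw [norm_mul, norm_unit, one_mul, norm_pow, Complex.norm_real, Real.norm_of_nonneg
    (Real.sqrt_nonneg _), ← pow_mul, mul_comm, pow_mul, Real.sq_sqrt (Nat.cast_nonneg p)]

/-- An integer combination of `p`-th roots of unity of absolute value `√p ^ m` is
`± μ * √p ^ m` times a root of unity. -/
theorem exists_eq_unit_mul_sqrt_pow {p : ℕ} [hp : Fact p.Prime] (hp2 : p ≠ 2) {m k : ℕ}
    (hk : Even k ↔ Even m) (c : ZMod p → ℤ)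
    (hc : ‖∑ i, (c i : ℂ) * ZMod.stdAddChar i‖ ^ 2 = (p : ℝ) ^ m) :
    ∃ j : ZMod p,
      ∑ i, (c i : ℂ) * ZMod.stdAddChar i =
        unit p k * ((√(p : ℝ) : ℝ) : ℂ) ^ m * ZMod.stdAddChar j ∨
      ∑ i, (c i : ℂ) * ZMod.stdAddChar i =
        -(unit p k * ((√(p : ℝ) : ℝ) : ℂ) ^ m * ZMod.stdAddChar j) := by
  obtain ⟨d, hd, -⟩ := exists_coeff_unit_mul_sqrt_pow hp2 m
  rw [unit_congr (hp.out.odd_of_ne_two hp2) hk]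
  have hn := norm_unit_mul_sqrt_pow_sq p m m
  rw [hd] at hn ⊢
  exact eq_or_eq_neg_mul_stdAddChar hp2 m c d hc hn

end GaussSum

/-! ### Character sums and fibre sizes. -/

section FiberSum

variable {p : ℕ} [Fact p.Prime]

/-- Sums of characters in terms of the sizes of fibres. -/
theorem sum_mul_stdAddChar_eq {ι : Type*} (s : Finset ι) (w : ι → ℤ) (h : ι → ZMod p) :
    ∑ a ∈ s, (w a : ℂ) * ZMod.stdAddChar (h a) =
      ∑ i, ((∑ a ∈ s with h a = i, w a : ℤ) : ℂ) * ZMod.stdAddChar i := by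
  rw [← Finset.sum_fiberwise s h]
  refine Finset.sum_congr rfl fun i _ => ?_
  rw [Int.cast_sum, Finset.sum_mul]
  refine Finset.sum_congr rfl fun a ha => ?_
  rw [(Finset.mem_filter.1 ha).2]

theorem sum_stdAddChar_eq {ι : Type*} (s : Finset ι) (h : ι → ZMod p) :
    ∑ a ∈ s, (ZMod.stdAddChar (h a) : ℂ) =
      ∑ i, (((s.filter fun a => h a = i).card : ℤ) : ℂ) * ZMod.stdAddChar i := by
  have := sum_mul_stdAddChar_eq s (fun _ => 1) h
  simpa using this

theorem sum_mul_stdAddChar_mul (c : ZMod p → ℤ) (j : ZMod p) :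
    (∑ i, (c i : ℂ) * ZMod.stdAddChar i) * ZMod.stdAddChar j =
      ∑ i, (c (i - j) : ℂ) * ZMod.stdAddChar i := by
  rw [Finset.sum_mul]
  refine Fintype.sum_equiv (Equiv.addRight j) _ _ fun i => ?_
  simp [AddChar.map_add_eq_mul, mul_assoc]

/-- The roots of unity have no relation besides their vanishing sum. In the applications the
constant is found from the total of the fibre sizes or used only modulo 2. -/
theorem exists_const_of_sum_stdAddChar_eq (c d : ZMod p → ℤ)
    (h : ∑ i, (c i : ℂ) * ZMod.stdAddChar i = ∑ i, (d i : ℂ) * ZMod.stdAddChar i) :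
    ∃ e : ℤ, ∀ i, c i = d i + e := by
  refine ⟨c 0 - d 0, fun i => ?_⟩
  have := coeff_eq_of_sum_stdAddChar_eq_zero (fun i => c i - d i) (by
    simp [sub_mul, h]) i 0
  linarith

end FiberSum

/-! ### Walsh values of `f` and of its dual, parity arguments, and solution counts. -/

section Plateaued

open Module

variable {p : ℕ} [hp : Fact p.Prime] {V : Type*} [AddCommGroup V] [Module (ZMod p) V] [Fintype V]
  {B : LinearMap.BilinForm (ZMod p) V} {f : V → ZMod p} {s : ℕ}

theorem card_eq_pow_finrank_zmod : Fintype.card V = p ^ finrank (ZMod p) V := by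
  rw [Module.card_eq_pow_finrank (K := ZMod p) (V := V), ZMod.card]

theorem sum_stdAddChar_bilin [DecidableEq V] (hB : B.Nondegenerate) (x : V) :
    ∑ α : V, (ZMod.stdAddChar (B α x) : ℂ) = if x = 0 then (p : ℂ) ^ finrank (ZMod p) V else 0 := by
  split_ifs with hx
  · simp [hx, card_eq_pow_finrank_zmod (p := p)]
  · set χ : AddChar V ℂ := ZMod.stdAddChar.compAddMonoidHom (B.flip x).toAddMonoidHom with hχ
    have hne : χ ≠ 1 := by
      intro h
      refine hx (hB.2 x fun α => ?_)
      have h1 : (ZMod.stdAddChar (B α x) : ℂ) = 1 := congrFun (congrArg DFunLike.coe h) α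
      rwa [← (ZMod.stdAddChar (N := p)).map_zero_eq_one, ZMod.injective_stdAddChar.eq_iff] at h1
    exact AddChar.sum_eq_zero_of_ne_one hne

theorem walsh_inversion (hB : B.Nondegenerate) (f : V → ZMod p) (x : V) :
    ∑ α : V, walsh B f α * ZMod.stdAddChar (B α x) =
      (p : ℂ) ^ finrank (ZMod p) V * ZMod.stdAddChar (f x) := by
  classical
  calc ∑ α : V, walsh B f α * ZMod.stdAddChar (B α x)
      = ∑ α : V, ∑ y : V, ZMod.stdAddChar (f y) * ZMod.stdAddChar (B α (x - y)) := by
        refine Finset.sum_congr rfl fun α _ => ?_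
        rw [walsh, Finset.sum_mul]
        refine Finset.sum_congr rfl fun y _ => ?_
        rw [← AddChar.map_add_eq_mul, ← AddChar.map_add_eq_mul, map_sub]
        congr 1; ring
    _ = ∑ y : V, ZMod.stdAddChar (f y) * ∑ α : V, (ZMod.stdAddChar (B α (x - y)) : ℂ) := by
        rw [Finset.sum_comm]
        simp only [Finset.mul_sum]
    _ = _ := by
        simp only [sum_stdAddChar_bilin hB, sub_eq_zero]
        simp [mul_comm]

theorem sum_norm_walsh_sq (hB : B.Nondegenerate) (f : V → ZMod p) :
    ∑ α : V, ‖walsh B f α‖ ^ 2 = (p : ℝ) ^ (2 * finrank (ZMod p) V) := by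
  have h : ∑ α : V, ((‖walsh B f α‖ ^ 2 : ℝ) : ℂ) = (p : ℂ) ^ (2 * finrank (ZMod p) V) := by
    calc ∑ α : V, ((‖walsh B f α‖ ^ 2 : ℝ) : ℂ)
        = ∑ α : V, walsh B f α * ∑ x : V, ZMod.stdAddChar (-f x) * ZMod.stdAddChar (B α x) := by
          refine Finset.sum_congr rfl fun α _ => ?_
          rw [← Complex.normSq_eq_norm_sq, ← Complex.mul_conj]
          congr 1
          rw [walsh, map_sum]
          refine Finset.sum_congr rfl fun x _ => ?_
          rw [← AddChar.map_neg_eq_conj, ← AddChar.map_add_eq_mul]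
          congr 1; ring
      _ = ∑ x : V, ZMod.stdAddChar (-f x) * ∑ α : V, walsh B f α * ZMod.stdAddChar (B α x) := by
          simp only [Finset.mul_sum]
          rw [Finset.sum_comm]
          exact Finset.sum_congr rfl fun x _ => Finset.sum_congr rfl fun α _ => by ring
      _ = ∑ x : V, (p : ℂ) ^ finrank (ZMod p) V := by
          refine Finset.sum_congr rfl fun x _ => ?_
          rw [walsh_inversion hB, mul_left_comm, ← AddChar.map_add_eq_mul]
          simp
      _ = _ := by
          simp [card_eq_pow_finrank_zmod (p := p)]; ring
  exact_mod_cast h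

theorem mem_walshSupport_iff (α : V) : α ∈ walshSupport B f s ↔
    ‖walsh B f α‖ = √(p : ℝ) ^ (finrank (ZMod p) V + s) := by
  simp [walshSupport]

omit hp in
theorem sqrt_pow_sq (m : ℕ) : (√(p : ℝ) ^ m) ^ 2 = (p : ℝ) ^ m := by
  rw [← pow_mul, mul_comm, pow_mul, Real.sq_sqrt (Nat.cast_nonneg p)]

theorem IsPlateaued.walsh_eq_zero (hf : IsPlateaued B f s) {α : V}
    (hα : α ∉ walshSupport B f s) : walsh B f α = 0 := by
  rw [mem_walshSupport_iff] at hα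
  exact norm_eq_zero.1 ((hf.2 α).resolve_right hα)

/-- Parseval: each support point contributes `p ^ (n + s)` to the total `p ^ (2 * n)`. -/
theorem IsPlateaued.card_walshSupport (hB : B.Nondegenerate) (hf : IsPlateaued B f s) :
    (walshSupport B f s).card = p ^ (finrank (ZMod p) V - s) := by
  classical
  have h := sum_norm_walsh_sq hB f
  rw [← Finset.sum_subset (Finset.subset_univ (walshSupport B f s))
    (fun α _ hα => by simp [hf.walsh_eq_zero hα]),
    Finset.sum_congr rfl (fun α hα => by rw [(mem_walshSupport_iff α).1 hα, sqrt_pow_sq]),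
    Finset.sum_const, nsmul_eq_mul] at h
  have h' : (walshSupport B f s).card * p ^ (finrank (ZMod p) V + s) =
      p ^ (2 * finrank (ZMod p) V) := by exact_mod_cast h
  have hs := hf.1
  rw [show 2 * finrank (ZMod p) V = (finrank (ZMod p) V - s) + (finrank (ZMod p) V + s) by omega,
    pow_add _ (finrank (ZMod p) V - s)] at h'
  exact Nat.eq_of_mul_eq_mul_right (pow_pos hp.out.pos _) h'

theorem walsh_eq_sum (B : LinearMap.BilinForm (ZMod p) V) (f : V → ZMod p) (α : V) :
    walsh B f α = ∑ i, (((Finset.univ.filter fun x => f x - B α x = i).card : ℤ) : ℂ) *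
      ZMod.stdAddChar i :=
  sum_stdAddChar_eq _ _

/-- A suitable exponent exists by the classification of cyclotomic integers of absolute value `√p ^
(n + s)`, so the choice made in `dual` is a genuine one. -/
theorem walsh_eq_or_eq_neg (hp2 : p ≠ 2) {α : V} (hα : α ∈ walshSupport B f s) :
    walsh B f α = walshValue p (finrank (ZMod p) V) s (dual B f s α) ∨
      walsh B f α = -walshValue p (finrank (ZMod p) V) s (dual B f s α) := by
  have hn : ‖walsh B f α‖ ^ 2 = (p : ℝ) ^ (finrank (ZMod p) V + s) := by
    rw [(mem_walshSupport_iff α).1 hα, sqrt_pow_sq]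
  have hex : ∃ j : ZMod p, walsh B f α = walshValue p (finrank (ZMod p) V) s j ∨
      walsh B f α = -walshValue p (finrank (ZMod p) V) s j := by
    rw [walsh_eq_sum] at hn ⊢
    exact exists_eq_unit_mul_sqrt_pow hp2 Iff.rfl _ hn
  exact Classical.epsilon_spec hex

theorem eps_eq_one_iff {α : V} : eps B f s α = 1 ↔ α ∈ bPlus B f s := by
  unfold eps; split_ifs <;> simp_all

theorem eps_of_notMem {α : V} (hα : α ∉ walshSupport B f s) : eps B f s α = 0 := by
  have h1 : α ∉ bPlus B f s := fun h => hα (Finset.mem_filter.1 h).1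
  have h2 : α ∉ bMinus B f s := fun h => hα (Finset.mem_filter.1 h).1
  rw [eps, if_neg h1, if_neg h2]

theorem eps_eq_one_or_neg_one (hp2 : p ≠ 2) {α : V} (hα : α ∈ walshSupport B f s) :
    eps B f s α = 1 ∨ eps B f s α = -1 := by
  classical
  unfold eps
  split_ifs with h1 h2
  · exact Or.inl rfl
  · exact Or.inr rfl
  · simp only [bPlus, bMinus, Finset.mem_filter, hα, true_and] at h1 h2
    exact absurd (walsh_eq_or_eq_neg hp2 hα) (by tauto)

/-- The Walsh values in terms of the signs `ε_α` and of the dual function. -/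
theorem IsPlateaued.walsh_eq (hp2 : p ≠ 2) (hf : IsPlateaued B f s) (α : V) :
    walsh B f α = (eps B f s α : ℂ) * walshValue p (finrank (ZMod p) V) s (dual B f s α) := by
  classical
  by_cases hα : α ∈ walshSupport B f s
  · unfold eps
    split_ifs with h1 h2
    · rw [(Finset.mem_filter.1 h1).2]; simp
    · rw [(Finset.mem_filter.1 h2).2]; simp
    · simp only [bPlus, bMinus, Finset.mem_filter, hα, true_and] at h1 h2
      exact absurd (walsh_eq_or_eq_neg hp2 hα) (by tauto)
  · rw [hf.walsh_eq_zero hα, eps_of_notMem hα]; simp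

theorem unit_mul_unit (p m : ℕ) : unit p m * unit p m = 1 ∨ unit p m * unit p m = -1 := by
  unfold unit; split_ifs <;> simp

/-- The signed character sum over the Walsh support. -/
theorem IsPlateaued.sum_eps_mul (hp2 : p ≠ 2) (hB : B.Nondegenerate) (hf : IsPlateaued B f s)
    (x : V) :
    ∑ α ∈ walshSupport B f s, (eps B f s α : ℂ) * ZMod.stdAddChar (dual B f s α + B α x) =
        walshDualValue p (finrank (ZMod p) V) s (f x) ∨
      ∑ α ∈ walshSupport B f s, (eps B f s α : ℂ) * ZMod.stdAddChar (dual B f s α + B α x) =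
        -walshDualValue p (finrank (ZMod p) V) s (f x) := by
  classical
  set n := finrank (ZMod p) V with hn
  set u := ∑ α ∈ walshSupport B f s, (eps B f s α : ℂ) * ZMod.stdAddChar (dual B f s α + B α x)
    with hu
  set r : ℂ := ((√(p : ℝ) : ℝ) : ℂ) with hr
  have hr0 : r ≠ 0 := by
    rw [hr, Complex.ofReal_ne_zero]
    exact (Real.sqrt_pos.2 (Nat.cast_pos.2 hp.out.pos)).ne'
  have h1 : unit p (n + s) * r ^ (n + s) * u = (p : ℂ) ^ n * ZMod.stdAddChar (f x) := by
    rw [← walsh_inversion hB f x, ← Finset.sum_subset (Finset.subset_univ (walshSupport B f s))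
      (fun α _ hα => by simp [hf.walsh_eq_zero hα]), hu, Finset.mul_sum]
    refine Finset.sum_congr rfl fun α _ => ?_
    rw [hf.walsh_eq hp2 α, walshValue, AddChar.map_add_eq_mul]
    ring
  have h2 : r ^ (n + s) * r ^ (n - s) = (p : ℂ) ^ n := by
    rw [← pow_add, show n + s + (n - s) = 2 * n by have := hf.1; omega, sqrt_pow_two_mul]
  have h3 : unit p (n + s) * u = r ^ (n - s) * ZMod.stdAddChar (f x) := by
    apply mul_left_cancel₀ (pow_ne_zero (n + s) hr0)
    rw [← mul_assoc, ← mul_assoc, h2, ← h1]; ring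
  -- Inversion yields `μ⁻¹`, while `walshDualValue` contains `μ`; the two differ by `μ ^ 2 = ± 1`,
  -- whence the undetermined sign.
  have h4 : unit p (n + s) * unit p (n + s) * u = walshDualValue p n s (f x) := by
    rw [mul_assoc, h3, walshDualValue]; ring
  rcases unit_mul_unit p (n + s) with h | h <;> rw [h] at h4
  · left; rw [← h4]; ring
  · right; rw [← h4]; ring

theorem walshDual_eq_sum (B : LinearMap.BilinForm (ZMod p) V) (f : V → ZMod p) (s : ℕ) (α : V) :
    walshDual B f s α = ∑ i,
      ((((walshSupport B f s).filter fun x => dual B f s x - B α x = i).card : ℤ) : ℂ) *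
      ZMod.stdAddChar i :=
  sum_stdAddChar_eq _ _

theorem even_sub_iff {n s : ℕ} (hs : s ≤ n) : Even (n + s) ↔ Even (n - s) := by
  rw [Nat.even_iff, Nat.even_iff]; omega

/-- Modulo `2`, the fibre sizes in a sum equal to `± μ * √p ^ m * ξ ^ j` single out `j`. -/
theorem exists_const_of_eq_unit_mul (hp2 : p ≠ 2) {m k : ℕ} (hk : Even k ↔ Even m)
    (N : ZMod p → ℤ) (j : ZMod p)
    (h : ∑ i, (N i : ℂ) * ZMod.stdAddChar i =
        unit p k * ((√(p : ℝ) : ℝ) : ℂ) ^ m * ZMod.stdAddChar j ∨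
      ∑ i, (N i : ℂ) * ZMod.stdAddChar i =
        -(unit p k * ((√(p : ℝ) : ℝ) : ℂ) ^ m * ZMod.stdAddChar j)) :
    ∃ e : ZMod 2, ∀ i, (N i : ZMod 2) = e + if i = j then 1 else 0 := by
  obtain ⟨c, hc, e, he⟩ := exists_coeff_unit_mul_sqrt_pow hp2 m
  rw [unit_congr (hp.out.odd_of_ne_two hp2) hk, hc, sum_mul_stdAddChar_mul] at h
  have hneg : ∀ a : ZMod 2, -a = a := by decide
  rcases h with h | h
  · obtain ⟨d, hd⟩ := exists_const_of_sum_stdAddChar_eq _ _ h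
    refine ⟨d + e, fun i => ?_⟩
    rw [hd i, Int.cast_add, he]
    simp only [sub_eq_zero]; ring
  · rw [← Finset.sum_neg_distrib] at h
    obtain ⟨d, hd⟩ := exists_const_of_sum_stdAddChar_eq N (fun i => -c (i - j))
      (h.trans (Finset.sum_congr rfl fun i _ => by push_cast; ring))
    refine ⟨d + e, fun i => ?_⟩
    rw [hd i, Int.cast_add, Int.cast_neg, he, hneg]
    simp only [sub_eq_zero]; ring

theorem exists_ne_ne (hp2 : p ≠ 2) (j k : ZMod p) : ∃ i, i ≠ j ∧ i ≠ k := by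
  classical
  by_contra! h
  have h1 : (Finset.univ : Finset (ZMod p)) ⊆ {j, k} := fun i _ => by
    by_cases hi : i = j
    · simp [hi]
    · simp [h i hi]
  have h2 := (Finset.card_le_card h1).trans Finset.card_le_two
  rw [Finset.card_univ, ZMod.card] at h2
  exact hp2 (le_antisymm h2 hp.out.two_le)

/-- If the dual is bent relative to the Walsh support, its Walsh transform takes the values
`± μ * p ^ ((n - s) / 2) * ξ ^ f (-α)`. -/
theorem mem_bPlusDual_or_mem_bMinusDual (hp2 : p ≠ 2) (hB : B.Nondegenerate) (hsymm : B.IsSymm)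
    (hf : IsPlateaued B f s) (hbent : DualIsBent B f s) (α : V) :
    α ∈ bPlusDual B f s ∨ α ∈ bMinusDual B f s := by
  classical
  set n := finrank (ZMod p) V with hn
  have hnorm : ‖walshDual B f s α‖ ^ 2 = (p : ℝ) ^ (n - s) := by
    rw [hbent α, Real.sq_sqrt (Nat.cast_nonneg _), hf.card_walshSupport hB]
    push_cast; rfl
  have hpar : Even (n + s) ↔ Even (n - s) := even_sub_iff hf.1
  have hj : ∃ j, walshDual B f s α = walshDualValue p n s j ∨
      walshDual B f s α = -walshDualValue p n s j := by
    rw [walshDual_eq_sum] at hnorm ⊢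
    exact exists_eq_unit_mul_sqrt_pow hp2 hpar _ hnorm
  obtain ⟨j, hj⟩ := hj
  suffices h : j = f (-α) by rw [h] at hj; exact hj
  have hu := hf.sum_eps_mul hp2 hB (-α)
  rw [sum_mul_stdAddChar_eq] at hu
  have hj' := hj
  rw [walshDual_eq_sum] at hj'
  obtain ⟨e₁, he₁⟩ := exists_const_of_eq_unit_mul hp2 hpar _ _ hj'
  obtain ⟨e₂, he₂⟩ := exists_const_of_eq_unit_mul hp2 hpar _ _ hu
  -- The sum for `W_{f*}(α)` and the one from Fourier inversion differ only by the signs `ε`, which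
  -- are odd; so their fibre weights agree modulo 2. One singles out `j`, the other `f (-α)`.
  have hcongr : ∀ i, ((((walshSupport B f s).filter fun x => dual B f s x - B α x = i).card : ℤ) :
      ZMod 2) = ((∑ x ∈ walshSupport B f s with dual B f s x + B x (-α) = i, eps B f s x : ℤ) :
      ZMod 2) := by
    intro i
    have hset : (walshSupport B f s).filter (fun x => dual B f s x + B x (-α) = i) =
        (walshSupport B f s).filter (fun x => dual B f s x - B α x = i) := by
      refine Finset.filter_congr fun x _ => ?_
      rw [map_neg, ← sub_eq_add_neg, hsymm.eq x α]
    rw [hset, Int.cast_sum, Finset.sum_congr rfl (g := fun _ => (1 : ZMod 2))]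
    · simp
    · intro x hx
      rcases eps_eq_one_or_neg_one hp2 (Finset.mem_filter.1 hx).1 with h | h <;> rw [h] <;> rfl
  have hall : ∀ i, e₁ + (if i = j then 1 else 0) = e₂ + if i = f (-α) then 1 else 0 := fun i => by
    rw [← he₁, ← he₂, hcongr]
  by_contra hne
  -- A third exponent, available since `p ≥ 3`, forces `e₁ = e₂`; evaluation at `j` then gives `1 =
  -- 0`.
  obtain ⟨i, hij, hif⟩ := exists_ne_ne hp2 j (f (-α))
  have h1 := hall i
  have h2 := hall j
  rw [if_neg hij, if_neg hif] at h1
  rw [if_pos rfl, if_neg hne, ← h1] at h2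
  simp at h2

-- Since `p - 1` is even and coprime to `t - 1`, the exponent `t` is even; take `a = -1`.
omit [Fintype V] in
theorem apply_neg_of_form {t : ℕ} {x : V} (hp2 : p ≠ 2) (ht : 2 ≤ t)
    (hgcd : Nat.gcd (t - 1) (p - 1) = 1)
    (h : ∀ a : ZMod p, a ≠ 0 → f (a • x) = a ^ t * f x) : f (-x) = f x := by
  have hodd : Odd p := hp.out.odd_of_ne_two hp2
  have hev : Even t := by
    by_contra hne
    have h1 : 2 ∣ t - 1 := by rw [Nat.even_iff] at hne; omega
    have h2 : 2 ∣ p - 1 := by obtain ⟨l, rfl⟩ := hodd; omega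
    have := Nat.dvd_gcd h1 h2
    rw [hgcd] at this
    omega
  have := h (-1) (neg_ne_zero.2 one_ne_zero)
  rwa [hev.neg_one_pow, one_mul, neg_smul, one_smul] at this

theorem ClassF.apply_neg (hp2 : p ≠ 2) (hB : B.Nondegenerate) (hsymm : B.IsSymm)
    (hf : ClassF B f s) (x : V) : f (-x) = f x := by
  obtain ⟨t, ht, -, hg, h⟩ := hf.form_plus
  obtain ⟨t', ht', -, hg', h'⟩ := hf.form_minus
  rcases mem_bPlusDual_or_mem_bMinusDual hp2 hB hsymm hf.plateaued hf.dual_bent x with hx | hx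
  · exact apply_neg_of_form hp2 ht hg fun a ha => h a x ha hx
  · exact apply_neg_of_form hp2 ht' hg' fun a ha => h' a x ha hx

theorem walsh_neg (hf : ∀ x, f (-x) = f x) (α : V) : walsh B f (-α) = walsh B f α := by
  refine Fintype.sum_equiv (Equiv.neg V) _ _ fun x => ?_
  simp [hf]

theorem dual_neg (hf : ∀ x, f (-x) = f x) (α : V) : dual B f s (-α) = dual B f s α := by
  simp only [dual, walsh_neg hf]

theorem neg_mem_walshSupport (hf : ∀ x, f (-x) = f x) {α : V} (hα : α ∈ walshSupport B f s) :
    -α ∈ walshSupport B f s := by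
  rwa [mem_walshSupport_iff, walsh_neg hf, ← mem_walshSupport_iff]

/-- Because `f` is even, negation acts on the part of the support where `f*` vanishes. That part has
odd size, as `f 0 = 0` singles out the exponent 0 and the support has odd size. So negation has a
fixed point, which can only be 0. -/
theorem ClassF.zero_mem (hp2 : p ≠ 2) (hB : B.Nondegenerate) (hsymm : B.IsSymm)
    (hf : ClassF B f s) : (0 : V) ∈ walshSupport B f s ∧ dual B f s 0 = 0 := by
  classical
  set S := (walshSupport B f s).filter fun x => dual B f s x = 0 with hS
  suffices h : (0 : V) ∈ S from Finset.mem_filter.1 h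
  have hneg := hf.apply_neg hp2 hB hsymm
  have hodd : Odd p := hp.out.odd_of_ne_two hp2
  have hp1 : (p : ZMod 2) = 1 := (ZMod.natCast_eq_one_iff_odd).2 hodd
  have hcard : (S.card : ZMod 2) = 1 := by
    have h := mem_bPlusDual_or_mem_bMinusDual hp2 hB hsymm hf.plateaued hf.dual_bent 0
    have h' : walshDual B f s 0 = walshDualValue p _ s (f (-0)) ∨
      walshDual B f s 0 = -walshDualValue p _ s (f (-0)) := h
    rw [neg_zero, hf.map_zero, walshDual_eq_sum] at h'
    obtain ⟨e, he⟩ := exists_const_of_eq_unit_mul hp2 (even_sub_iff hf.plateaued.1) _ _ h'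
    simp only [Int.cast_natCast] at he
    have hsum : ∑ i, (((walshSupport B f s).filter fun x => dual B f s x - B 0 x = i).card :
        ZMod 2) =
        1 := by
      rw [← Nat.cast_sum, ← Finset.card_eq_sum_card_fiberwise (fun x _ => Finset.mem_univ _),
        hf.plateaued.card_walshSupport hB, Nat.cast_pow, hp1, one_pow]
    simp only [he] at hsum
    rw [Finset.sum_add_distrib, Finset.sum_const, Finset.card_univ, ZMod.card] at hsum
    simp only [nsmul_eq_mul, hp1, one_mul, Finset.sum_ite_eq', Finset.mem_univ, if_true] at hsum
    have hS' : S = (walshSupport B f s).filter fun x => dual B f s x - B 0 x = 0 := by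
      simp [hS]
    rw [hS', he 0, if_pos rfl, hsum]
  by_contra h0
  have h2 : ∑ x ∈ S, (1 : ZMod 2) = 0 := by
    refine Finset.sum_involution (fun x _ => -x) (fun _ _ => rfl) ?_ ?_ (fun x _ => neg_neg x)
    · intro x hx _ hxx
      have h2x : (2 : ZMod p) • x = 0 := by
        rw [two_smul]; nth_rewrite 1 [← hxx]; simp
      have h20 : (2 : ZMod p) ≠ 0 := by
        intro h
        have h' : ((2 : ℕ) : ZMod p) = 0 := by exact_mod_cast h
        rw [ZMod.natCast_eq_zero_iff] at h'
        exact hp2 ((Nat.prime_dvd_prime_iff_eq hp.out Nat.prime_two).1 h')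
      rw [(smul_eq_zero.1 h2x).resolve_left h20] at hx
      exact h0 hx
    · intro x hx
      obtain ⟨h1, h2⟩ := Finset.mem_filter.1 hx
      exact Finset.mem_filter.2 ⟨neg_mem_walshSupport hneg h1, by rw [dual_neg hneg, h2]⟩
  rw [Finset.sum_const, nsmul_one, hcard] at h2
  exact one_ne_zero h2

/-- Here `μ √p ^ (n + s)` is the integer `p ^ ((n + s) / 2)`, so all fibres of `f - ⟨α, ·⟩` have
equal size except the one over `f*(α)`. Their total `p ^ n` fixes the common size; the factor `p`
avoids a division. -/
theorem IsPlateaued.card_eq_bilin_of_even (hp2 : p ≠ 2) (hf : IsPlateaued B f s)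
    (heven : Even (finrank (ZMod p) V + s)) (α : V) :
    (p : ℤ) * (Finset.univ.filter fun x => f x = B α x).card =
      p ^ finrank (ZMod p) V + eps B f s α * p ^ ((finrank (ZMod p) V + s) / 2) *
        (if dual B f s α = 0 then (p : ℤ) - 1 else -1) := by
  set n := finrank (ZMod p) V with hn
  set h := (n + s) / 2
  set j := dual B f s α
  have hw := hf.walsh_eq hp2 α
  rw [walsh_eq_sum, walshValue, unit_mul_sqrt_pow_of_even (hp.out.odd_of_ne_two hp2) heven] at hw
  have hw' : (eps B f s α : ℂ) * (((p ^ h : ℤ) : ℂ) * ZMod.stdAddChar j) =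
      ∑ i : ZMod p, ((if i = j then eps B f s α * p ^ h else 0 : ℤ) : ℂ) *
        ZMod.stdAddChar i := by
    rw [Finset.sum_eq_single j]
    · simp; ring
    · intro i _ hi; simp [hi]
    · simp
  obtain ⟨e, he⟩ := exists_const_of_sum_stdAddChar_eq _ _ (hw.trans hw')
  have hsum : ∑ i, ((Finset.univ.filter fun x => f x - B α x = i).card : ℤ) = p ^ n := by
    rw [← Nat.cast_sum, ← Finset.card_eq_sum_card_fiberwise (fun x _ => Finset.mem_univ _),
      Finset.card_univ, card_eq_pow_finrank_zmod (p := p)]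
    push_cast; rfl
  simp only [he] at hsum
  rw [Finset.sum_add_distrib] at hsum
  simp only [Finset.sum_ite_eq', Finset.mem_univ, if_true, Finset.sum_const, Finset.card_univ,
    ZMod.card, nsmul_eq_mul] at hsum
  have h0 := he 0
  simp only [sub_eq_zero] at h0
  rw [h0, ← hsum]
  by_cases hj : j = 0
  · rw [if_pos hj, if_pos hj.symm]; ring
  · rw [if_neg hj, if_neg (Ne.symm hj)]; ring

/-- Here the Walsh value is a signed multiple of a shifted Gauss sum, so the fibre sizes deviate
from `p ^ (n - 1)` by multiples of `χ(i - f*(α))`, which sum to zero. Over `i = 0` the deviation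
vanishes if `f*(α) = 0`. -/
theorem IsPlateaued.card_eq_bilin_of_odd (hp2 : p ≠ 2) (hf : IsPlateaued B f s)
    (hpos : 0 < finrank (ZMod p) V) (hodd : Odd (finrank (ZMod p) V + s)) (α : V) :
    ∃ r : ℤ, (r = 0 ∨ r = 1 ∨ r = -1) ∧ (dual B f s α = 0 → r = 0) ∧
      ((Finset.univ.filter fun x => f x = B α x).card : ℤ) =
        p ^ (finrank (ZMod p) V - 1) + r * p ^ ((finrank (ZMod p) V + s) / 2) := by
  set n := finrank (ZMod p) V with hn
  set h := (n + s) / 2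
  set j := dual B f s α
  have hw := hf.walsh_eq hp2 α
  obtain ⟨δ, hδ, hg⟩ := exists_unit_mul_sqrt_pow_of_odd hp2 hodd
  rw [walsh_eq_sum, walshValue, hg, sum_mul_stdAddChar_mul, Finset.mul_sum] at hw
  have hchar : ringChar (ZMod p) ≠ 2 := by rwa [ZMod.ringChar_zmod_n]
  obtain ⟨e, he⟩ := exists_const_of_sum_stdAddChar_eq _
    (fun i => eps B f s α * (δ * p ^ h * quadraticChar (ZMod p) (i - j))) (hw.trans
      (Finset.sum_congr rfl fun i _ => by push_cast; ring))
  have hsum : ∑ i, ((Finset.univ.filter fun x => f x - B α x = i).card : ℤ) = p ^ n := by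
    rw [← Nat.cast_sum, ← Finset.card_eq_sum_card_fiberwise (fun x _ => Finset.mem_univ _),
      Finset.card_univ, card_eq_pow_finrank_zmod (p := p)]
    push_cast; rfl
  simp only [he] at hsum
  have hchi : ∑ i, quadraticChar (ZMod p) (i - j) = 0 := by
    rw [← quadraticChar_sum_zero hchar]
    exact Fintype.sum_equiv (Equiv.subRight j) _ _ fun i => rfl
  rw [Finset.sum_add_distrib, ← Finset.mul_sum, ← Finset.mul_sum, hchi] at hsum
  simp only [mul_zero, zero_add, Finset.sum_const, Finset.card_univ,
    ZMod.card, nsmul_eq_mul] at hsum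
  have hpz : (p : ℤ) ≠ 0 := Nat.cast_ne_zero.2 hp.out.ne_zero
  have he' : e = p ^ (n - 1) := by
    apply mul_left_cancel₀ hpz
    rw [hsum, ← pow_succ', Nat.sub_add_cancel hpos]
  have h0 := he 0
  simp only [sub_eq_zero] at h0
  refine ⟨eps B f s α * (δ * quadraticChar (ZMod p) (0 - j)), ?_, ?_, ?_⟩
  · have h1 : eps B f s α = 0 ∨ eps B f s α = 1 ∨ eps B f s α = -1 := by
      unfold eps; split_ifs <;> simp
    have h2 := quadraticChar_isQuadratic (ZMod p) (0 - j)
    rcases h1 with h1 | h1 | h1 <;> rcases h2 with h2 | h2 | h2 <;> rcases hδ with h3 | h3 <;>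
      rw [h1, h2, h3] <;> simp
  · intro hj
    rw [hj]; simp
  · rw [h0, he']; ring

end Plateaued

/-! ### Zeros of `f` on hyperplanes. -/

section Counting

open Module

variable {p : ℕ} [hp : Fact p.Prime] {V : Type*} [AddCommGroup V] [Module (ZMod p) V] [Fintype V]
  {B : LinearMap.BilinForm (ZMod p) V} {f : V → ZMod p} {s : ℕ}

omit [Fintype V] in
theorem bilin_ne_zero (hB : B.Nondegenerate) {α : V} (hα : α ≠ 0) : B α ≠ 0 := fun h =>
  hα (hB.1 α fun x => by rw [h, LinearMap.zero_apply])

theorem finrank_ker_bilin (hB : B.Nondegenerate) {α : V} (hα : α ≠ 0) :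
    finrank (ZMod p) (LinearMap.ker (B α)) + 1 = finrank (ZMod p) V :=
  Module.Dual.finrank_ker_add_one_of_ne_zero (bilin_ne_zero hB hα)

theorem card_filter_mem (W : Submodule (ZMod p) V) [DecidablePred (· ∈ W)] :
    (Finset.univ.filter (· ∈ W)).card = p ^ finrank (ZMod p) W := by
  rw [← card_eq_pow_finrank_zmod (p := p) (V := W), Fintype.card_subtype]

theorem card_bilin_eq_zero (hB : B.Nondegenerate) {α : V} (hα : α ≠ 0) :
    (Finset.univ.filter fun x => 0 = B α x).card = p ^ (finrank (ZMod p) V - 1) := by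
  classical
  rw [← finrank_ker_bilin hB hα, Nat.add_sub_cancel, ← card_filter_mem]
  simp [eq_comm]

/-- If `f` is homogeneous of degree `t` on a scalar-invariant set, then multiplying `f` by a
scalar does not change the number of solutions of `f x = ⟨α, x⟩` in this set. -/
theorem card_filter_mul_eq (Q : V → Prop) [DecidablePred Q] {t : ℕ} (ht : 2 ≤ t)
    (hgcd : Nat.gcd (t - 1) (p - 1) = 1)
    (hQ : ∀ (a : ZMod p) (x : V), a ≠ 0 → Q x → Q (a • x))
    (hf : ∀ (a : ZMod p) (x : V), a ≠ 0 → Q x → f (a • x) = a ^ t * f x)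
    (α : V) {y : ZMod p} (hy : y ≠ 0) :
    (Finset.univ.filter fun x => Q x ∧ y * f x = B α x).card =
      (Finset.univ.filter fun x => Q x ∧ f x = B α x).card := by
  have hcop : (Nat.card (ZMod p)ˣ).Coprime (t - 1) := by
    rw [Nat.card_eq_fintype_card, ZMod.card_units, Nat.coprime_comm]; exact hgcd
  -- Since `t - 1` is prime to the order of the unit group, `b ^ (t - 1) = y⁻¹` is solvable. Then `y
  -- * f (b • x) = b * f x`, so `x ↦ b • x` carries one solution set onto the other.
  obtain ⟨b, hb⟩ := (powCoprime hcop).surjective (Units.mk0 y hy)⁻¹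
  have hb' : y * (b : ZMod p) ^ (t - 1) = 1 := by
    have h1 : (b ^ (t - 1) : (ZMod p)ˣ) = (Units.mk0 y hy)⁻¹ := hb
    have h2 := congrArg Units.val h1
    rw [Units.val_pow_eq_pow_val, Units.val_inv_eq_inv_val, Units.val_mk0] at h2
    rw [h2, mul_inv_cancel₀ hy]
  have hbt : y * (b : ZMod p) ^ t = b := by
    rw [← Nat.sub_add_cancel (show 1 ≤ t by omega), pow_succ, ← mul_assoc, hb', one_mul]
  symm
  refine Finset.card_bijective (fun x : V => (b : ZMod p) • x)
    (MulAction.bijective (b : (ZMod p)ˣ)) fun x => ?_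
  have hQx : Q x ↔ Q ((b : ZMod p) • x) := by
    refine ⟨hQ _ _ b.ne_zero, fun h => ?_⟩
    have := hQ (b : ZMod p)⁻¹ _ (inv_ne_zero b.ne_zero) h
    rwa [smul_smul, inv_mul_cancel₀ b.ne_zero, one_smul] at this
  simp only [Finset.mem_filter, Finset.mem_univ, true_and, ← hQx]
  refine and_congr_right fun hx => ?_
  rw [hf _ _ b.ne_zero hx, ← mul_assoc, hbt, map_smul, smul_eq_mul]
  exact (mul_right_inj' b.ne_zero).symm

theorem ClassF.card_mul_eq (hp2 : p ≠ 2) (hB : B.Nondegenerate) (hsymm : B.IsSymm)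
    (hf : ClassF B f s) (α : V) {y : ZMod p} (hy : y ≠ 0) :
    (Finset.univ.filter fun x => y * f x = B α x).card =
      (Finset.univ.filter fun x => f x = B α x).card := by
  classical
  have hcover := mem_bPlusDual_or_mem_bMinusDual hp2 hB hsymm hf.plateaued hf.dual_bent
  obtain ⟨t, ht, -, hg, h⟩ := hf.form_plus
  obtain ⟨t', ht', -, hg', h'⟩ := hf.form_minus
  have h1 := card_filter_mul_eq (B := B) (f := f) (· ∈ bPlusDual B f s) ht hg hf.smul_mem_plus h α hy
  -- The complement of `B₊(f*)` stands in for `B₋(f*)`: it lies inside it, is scalar-invariant too,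
  -- and makes the splitting of `V` disjoint by construction.
  have h2 := card_filter_mul_eq (B := B) (f := f) (· ∉ bPlusDual B f s) ht' hg'
    (fun a x ha hx hax => hx (by
      have := hf.smul_mem_plus a⁻¹ _ (inv_ne_zero ha) hax
      rwa [smul_smul, inv_mul_cancel₀ ha, one_smul] at this))
    (fun a x ha hx => h' a x ha ((hcover x).resolve_left hx)) α hy
  have hsplit : ∀ R : V → Prop, (Finset.univ.filter R).card =
      (Finset.univ.filter fun x => x ∈ bPlusDual B f s ∧ R x).card +
      (Finset.univ.filter fun x => x ∉ bPlusDual B f s ∧ R x).card := by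
    intro R
    rw [← Finset.card_filter_add_card_filter_not (s := Finset.univ.filter R)
      (· ∈ bPlusDual B f s), Finset.filter_filter, Finset.filter_filter]
    simp only [and_comm]
  have e1 := hsplit fun x => y * f x = B α x
  have e2 := hsplit fun x => f x = B α x
  have e : ∀ (R : V → Prop) (i j : DecidablePred R),
      (@Finset.filter V R i Finset.univ).card = (@Finset.filter V R j Finset.univ).card :=
    fun R i j => by congr
  calc _ = _ := e _ _ _
    _ = _ := e1
    _ = _ := congrArg₂ (· + ·) ((e _ _ _).trans (h1.trans (e _ _ _)))
        ((e _ _ _).trans (h2.trans (e _ _ _)))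
    _ = _ := e2.symm
    _ = _ := e _ _ _

/-- The number of zeros of `f` in the hyperplane `α^⊥`. -/
theorem ClassF.card_zeros_hyperplane (hp2 : p ≠ 2) (hB : B.Nondegenerate) (hsymm : B.IsSymm)
    (hf : ClassF B f s) {α : V} (hα : α ≠ 0) :
    (p - 1) * (Finset.univ.filter fun x => f x = B α x).card + p ^ (finrank (ZMod p) V - 1) +
        (Finset.univ.filter fun x => f x = 0).card =
      p ^ finrank (ZMod p) V + p * (Finset.univ.filter fun x => f x = 0 ∧ B α x = 0).card := by
  -- Pairs `(y, x)` with `y * f x = ⟨α, x⟩` are counted twice. By `y`: each `y ≠ 0` contributes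
  -- equally, and `y = 0` contributes the hyperplane `α^⊥`.
  have hleft : ∑ y : ZMod p, (Finset.univ.filter fun x => y * f x = B α x).card =
      (p - 1) * (Finset.univ.filter fun x => f x = B α x).card + p ^ (finrank (ZMod p) V - 1) := by
    rw [← Finset.sum_erase_add _ _ (Finset.mem_univ 0)]
    congr 1
    · rw [Finset.sum_congr rfl fun y hy => hf.card_mul_eq hp2 hB hsymm α (Finset.ne_of_mem_erase hy)]
      rw [Finset.sum_const, Finset.card_erase_of_mem (Finset.mem_univ _), Finset.card_univ,
        ZMod.card, smul_eq_mul]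
    · simp only [zero_mul]
      exact card_bilin_eq_zero hB hα
  have hswap : ∑ y : ZMod p, (Finset.univ.filter fun x => y * f x = B α x).card =
      ∑ x : V, (Finset.univ.filter fun y : ZMod p => y * f x = B α x).card := by
    simp only [Finset.card_filter]
    exact Finset.sum_comm
  -- By `x`: one `y` if `f x ≠ 0`; otherwise all `p` values or none, according to whether `x ∈ α^⊥`.
  have hx : ∀ x : V, (Finset.univ.filter fun y : ZMod p => y * f x = B α x).card +
      (if f x = 0 then 1 else 0) = 1 + p * (if f x = 0 ∧ B α x = 0 then 1 else 0) := by
    intro x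
    by_cases h0 : f x = 0
    · by_cases h1 : B α x = 0
      · simp [h0, h1, ZMod.card, add_comm]
      · simp [h0, h1, Ne.symm h1]
    · have : (Finset.univ.filter fun y : ZMod p => y * f x = B α x) = {B α x / f x} := by
        ext y; simp [eq_div_iff h0]
      simp [this, h0]
  have hsum := Finset.sum_congr (rfl : (Finset.univ : Finset V) = Finset.univ) fun x _ => hx x
  rw [Finset.sum_add_distrib, Finset.sum_add_distrib, ← Finset.mul_sum, ← Finset.card_filter,
    ← Finset.card_filter, ← hswap, hleft] at hsum
  rw [hsum, Finset.sum_const, Finset.card_univ, smul_eq_mul, mul_one,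
    card_eq_pow_finrank_zmod (p := p)]

end Counting

/-! ### From zeros of `f` to projective points. -/

section Transversal

open Module

variable {p : ℕ} [hp : Fact p.Prime] {V : Type*} [AddCommGroup V] [Module (ZMod p) V]
  {m : ℕ} {x : Fin m → V} {E : Set V}

theorem IsScalarTransversal.mem_iff (hD : IsScalarTransversal (p := p) (Set.range x) E) {v : V} :
    v ∈ E ↔ ∃ (a : (ZMod p)ˣ) (i : Fin m), (a : ZMod p) • x i = v := by
  rw [← hD.1]; simp

theorem IsScalarTransversal.smul_injective (hx : Function.Injective x)
    (hD : IsScalarTransversal (p := p) (Set.range x) E) {a b : (ZMod p)ˣ} {i j : Fin m}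
    (h : (a : ZMod p) • x i = (b : ZMod p) • x j) : a = b ∧ i = j := by
  have hab : a = b := by
    by_contra hne
    exact Set.disjoint_left.1 (hD.2 a b hne) ⟨x i, ⟨i, rfl⟩, rfl⟩ ⟨x j, ⟨j, rfl⟩, h.symm⟩
  subst hab
  have h' := congrArg (fun v => ((a⁻¹ : (ZMod p)ˣ) : ZMod p) • v) h
  simp only [smul_smul, Units.inv_mul, one_smul] at h'
  exact ⟨rfl, hx h'⟩

/-- Representatives of the scalar classes are pairwise linearly independent. -/
theorem IsScalarTransversal.pairwise (hx : Function.Injective x)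
    (hD : IsScalarTransversal (p := p) (Set.range x) E) (hE : (0 : V) ∉ E) {i j : Fin m}
    (hij : i ≠ j) {a b : ZMod p} (h : a • x i + b • x j = 0) : a = 0 ∧ b = 0 := by
  have hne : ∀ i, x i ≠ 0 := fun i h0 => hE (hD.mem_iff.2 ⟨1, i, by simp [h0]⟩)
  by_cases ha : a = 0
  · rw [ha, zero_smul, zero_add, smul_eq_zero] at h
    exact ⟨ha, h.resolve_right (hne j)⟩
  · by_cases hb : b = 0
    · rw [hb, zero_smul, add_zero, smul_eq_zero] at h
      exact ⟨h.resolve_right (hne i), hb⟩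
    · refine absurd (hD.smul_injective hx (a := Units.mk0 a ha) (b := Units.mk0 (-b)
        (neg_ne_zero.2 hb)) (i := i) (j := j) ?_).2 hij
      rw [Units.val_mk0, Units.val_mk0, neg_smul]
      exact eq_neg_of_add_eq_zero_left h

theorem IsScalarTransversal.card_filter [Fintype V] (hx : Function.Injective x)
    (hD : IsScalarTransversal (p := p) (Set.range x) E) (R : V → Prop) [DecidablePred R]
    [DecidablePred (· ∈ E)] (hR : ∀ (a : (ZMod p)ˣ) (v : V), R ((a : ZMod p) • v) ↔ R v) :
    (Finset.univ.filter fun v => v ∈ E ∧ R v).card =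
      (p - 1) * (Finset.univ.filter fun i => R (x i)).card := by
  rw [← ZMod.card_units p, ← Finset.card_univ, ← Finset.card_product]
  symm
  refine Finset.card_bij (fun q _ => (q.1 : ZMod p) • x q.2) ?_ ?_ ?_
  · rintro ⟨a, i⟩ hq
    simp only [Finset.mem_product, Finset.mem_univ, true_and, Finset.mem_filter] at hq ⊢
    exact ⟨hD.mem_iff.2 ⟨a, i, rfl⟩, (hR _ _).2 hq⟩
  · rintro ⟨a, i⟩ _ ⟨b, j⟩ _ h
    obtain ⟨h1, h2⟩ := hD.smul_injective hx h
    exact Prod.ext h1 h2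
  · intro v hv
    obtain ⟨hvE, hvR⟩ := (Finset.mem_filter.1 hv).2
    obtain ⟨a, i, rfl⟩ := hD.mem_iff.1 hvE
    exact ⟨(a, i), by simpa using (hR _ _).1 hvR, rfl⟩

/-- Each point stands for `p - 1` zeros of `f`; the extra 1 is the zero vector. -/
theorem IsScalarTransversal.card_zeros [Fintype V] {f : V → ZMod p} (hf : f 0 = 0)
    (hx : Function.Injective x)
    (hD : IsScalarTransversal (p := p) (Set.range x) ({v : V | f v = 0} \ {0}))
    (R : V → Prop) [DecidablePred R] (hR0 : R 0)
    (hR : ∀ (a : (ZMod p)ˣ) (v : V), R ((a : ZMod p) • v) ↔ R v) :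
    (Finset.univ.filter fun v => f v = 0 ∧ R v).card =
      (p - 1) * (Finset.univ.filter fun i => R (x i)).card + 1 := by
  classical
  rw [← hD.card_filter hx R hR, ← Finset.card_erase_add_one (a := (0 : V)) (by simp [hf, hR0])]
  congr 2
  ext v
  simp only [Finset.mem_erase, Finset.mem_filter, Finset.mem_univ, true_and, Set.mem_sdiff,
    Set.mem_ofPred_eq, Set.mem_singleton_iff]
  tauto

/-- The number of points of the transversal in a hyperplane. -/
theorem ClassF.card_transversal_hyperplane [Fintype V] {B : LinearMap.BilinForm (ZMod p) V}
    {f : V → ZMod p} {s : ℕ} (hp2 : p ≠ 2) (hB : B.Nondegenerate) (hsymm : B.IsSymm)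
    (hf : ClassF B f s) (hx : Function.Injective x)
    (hD : IsScalarTransversal (p := p) (Set.range x) ({v : V | f v = 0} \ {0}))
    {α : V} (hα : α ≠ 0) :
    (p : ℤ) * (Finset.univ.filter fun i => B α (x i) = 0).card =
      m - 1 + ((Finset.univ.filter fun v => f v = B α v).card -
        (p : ℤ) ^ (finrank (ZMod p) V - 1)) := by
  have h := hf.card_zeros_hyperplane hp2 hB hsymm hα
  have h0 := hD.card_zeros hf.map_zero hx (fun _ => True) trivial (fun _ _ => Iff.rfl)
  have h1 := hD.card_zeros hf.map_zero hx (fun v => B α v = 0) (B α).map_zero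
    (fun a v => by simp)
  simp only [and_true, Finset.filter_true, Finset.card_univ, Fintype.card_fin] at h0
  rw [h0, h1] at h
  have hn : finrank (ZMod p) V ≠ 0 := by
    have := finrank_ker_bilin hB hα
    omega
  have hpow : p ^ finrank (ZMod p) V = p * p ^ (finrank (ZMod p) V - 1) := by
    rw [← pow_succ', Nat.sub_add_cancel (Nat.pos_of_ne_zero hn)]
  rw [hpow] at h
  have hp1 : (1 : ℤ) < p := by exact_mod_cast hp.out.one_lt
  zify [hp.out.one_le] at h
  apply mul_left_cancel₀ (sub_ne_zero.2 hp1.ne')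
  linarith

end Transversal

/-! ### The dual code as the space of linear relations among the points. -/

section Codes

open Module

variable {p : ℕ} [hp : Fact p.Prime] {V : Type*} [AddCommGroup V] [Module (ZMod p) V]
  {m : ℕ} {x : Fin m → V}

/-- The product of `u` with the codeword of `a` is `⟨a, ∑ u i • x i⟩`, and only 0 is orthogonal to
all of `V`. -/
theorem mem_dualCode_iff {B : LinearMap.BilinForm (ZMod p) V} (hB : B.Nondegenerate)
    {u : Fin m → ZMod p} :
    u ∈ dualCode (definingSetCode B x) ↔ ∑ i, u i • x i = 0 := by
  have h : u ∈ dualCode (definingSetCode B x) ↔ ∀ a : V, B a (∑ i, u i • x i) = 0 := by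
    have h1 : ∀ a : V, B a (∑ i, u i • x i) =
        u ⬝ᵥ (LinearMap.pi (fun i => B.flip (x i)) : V →ₗ[ZMod p] Fin m → ZMod p) a := by
      intro a
      simp [dotProduct, map_sum]
    simp only [h1]
    exact ⟨fun h a => h _ ⟨a, rfl⟩, by rintro h _ ⟨a, rfl⟩; exact h a⟩
  rw [h]
  exact ⟨fun h => hB.2 _ h, fun h a => by rw [h, map_zero]⟩

/-- The dual code has dimension `m - n` if no hyperplane contains all points. -/
theorem finrank_dualCode [FiniteDimensional (ZMod p) V] {B : LinearMap.BilinForm (ZMod p) V}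
    (hB : B.Nondegenerate)
    (hspan : ∀ α : V, (∀ i, B α (x i) = 0) → α = 0) :
    (finrank (ZMod p) (dualCode (definingSetCode B x)) : ℤ) = m - finrank (ZMod p) V := by
  set T := Fintype.linearCombination (ZMod p) x with hT
  have hker : dualCode (definingSetCode B x) = LinearMap.ker T := by
    ext u
    rw [mem_dualCode_iff hB, LinearMap.mem_ker, hT, Fintype.linearCombination_apply]
  have hrange : LinearMap.range T = ⊤ := by
    -- A proper span is killed by a non-zero functional, which is `B α` for some `α` by
    -- nondegeneracy.
    by_contra hne
    obtain ⟨φ, hφ, hle⟩ := Submodule.exists_le_ker_of_lt_top _ (lt_top_iff_ne_top.2 hne)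
    obtain ⟨α, rfl⟩ := (LinearMap.BilinForm.toDual B hB).surjective φ
    refine hφ ?_
    rw [hspan α fun i => ?_, map_zero]
    have := hle ⟨Pi.single i 1, rfl⟩
    simpa [hT, Fintype.linearCombination_apply_single, LinearMap.BilinForm.toDual_def] using this
  have h := LinearMap.finrank_range_add_finrank_ker T
  rw [hrange, finrank_top, finrank_fin_fun, ← hker] at h
  omega

theorem hasMinDist_of_hammingNorm {C : Submodule (ZMod p) (Fin m → ZMod p)} {d : ℕ}
    (hle : ∀ u ∈ C, u ≠ 0 → d ≤ hammingNorm u) (hex : ∃ u ∈ C, u ≠ 0 ∧ hammingNorm u ≤ d) :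
    HasMinDist C d := by
  obtain ⟨u, hu, hu0, hud⟩ := hex
  refine ⟨⟨u, hu, 0, C.zero_mem, hu0, ?_⟩, ?_⟩
  · rw [hammingDist_zero_right]
    exact le_antisymm hud (hle u hu hu0)
  · rintro e ⟨u, hu, v, hv, huv, rfl⟩
    rw [hammingDist_eq_hammingNorm]
    exact hle _ (C.add_mem (C.neg_mem hu) hv) (neg_add_eq_zero.not.2 huv)

/-- Any two of the vectors are linearly independent. -/
def PairwiseIndep (x : Fin m → V) : Prop :=
  ∀ i j, i ≠ j → ∀ a b : ZMod p, a • x i + b • x j = 0 → a = 0 ∧ b = 0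

/-- Any three of the vectors are linearly independent, i.e. the points are the points of a cap. -/
def IsCap (x : Fin m → V) : Prop :=
  ∀ i j k, i ≠ j → i ≠ k → j ≠ k → ∀ a b c : ZMod p,
    a • x i + b • x j + c • x k = 0 → a = 0 ∧ b = 0 ∧ c = 0

theorem sum_eq_sum_support (u : Fin m → ZMod p) :
    ∑ i, u i • x i = ∑ i ∈ Finset.univ.filter (fun i => u i ≠ 0), u i • x i := by
  symm
  refine Finset.sum_subset (Finset.subset_univ _) fun i _ hi => ?_
  have : u i = 0 := by simpa using hi
  rw [this, zero_smul]

theorem PairwiseIndep.three_le_hammingNorm (hx : PairwiseIndep (p := p) x) (hne : ∀ i, x i ≠ 0)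
    {u : Fin m → ZMod p} (hu : ∑ i, u i • x i = 0) (hu0 : u ≠ 0) : 3 ≤ hammingNorm u := by
  by_contra hlt
  rw [sum_eq_sum_support] at hu
  obtain ⟨i₀, hi₀⟩ := Function.ne_iff.1 hu0
  have hcard : (Finset.univ.filter fun i => u i ≠ 0).card < 3 := not_le.1 hlt
  interval_cases hc : (Finset.univ.filter fun i => u i ≠ 0).card
  · have := Finset.card_eq_zero.1 hc
    have hmem : i₀ ∈ Finset.univ.filter fun i => u i ≠ 0 := by simpa using hi₀
    rw [this] at hmem
    exact absurd hmem (Finset.notMem_empty _)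
  · obtain ⟨i, hi⟩ := Finset.card_eq_one.1 hc
    have hui : u i ≠ 0 := by
      have : i ∈ Finset.univ.filter fun i => u i ≠ 0 := by rw [hi]; simp
      simpa using this
    rw [hi, Finset.sum_singleton, smul_eq_zero] at hu
    exact hu.elim hui (hne i)
  · obtain ⟨i, j, hij, hi⟩ := Finset.card_eq_two.1 hc
    have hui : u i ≠ 0 := by
      have : i ∈ Finset.univ.filter fun i => u i ≠ 0 := by rw [hi]; simp
      simpa using this
    rw [hi, Finset.sum_pair hij] at hu
    exact hui (hx i j hij _ _ hu).1

theorem IsCap.four_le_hammingNorm (hcap : IsCap (p := p) x) (hx : PairwiseIndep (p := p) x)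
    (hne : ∀ i, x i ≠ 0) {u : Fin m → ZMod p} (hu : ∑ i, u i • x i = 0) (hu0 : u ≠ 0) :
    4 ≤ hammingNorm u := by
  refine Nat.lt_of_le_of_ne (hx.three_le_hammingNorm hne hu hu0) fun h3 => ?_
  rw [sum_eq_sum_support] at hu
  obtain ⟨i, j, k, hij, hik, hjk, hi⟩ := Finset.card_eq_three.1
    (show (Finset.univ.filter fun i => u i ≠ 0).card = 3 from h3.symm)
  have hui : u i ≠ 0 := by
    have : i ∈ Finset.univ.filter fun i => u i ≠ 0 := by rw [hi]; simp
    simpa using this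
  rw [hi, Finset.sum_insert (by simp [hij, hik]), Finset.sum_pair hjk, ← add_assoc] at hu
  exact hui (hcap i j k hij hik hjk _ _ _ hu).1

theorem exists_hammingNorm_le_three_of_not_isCap (h : ¬ IsCap (p := p) x) :
    ∃ u : Fin m → ZMod p, ∑ i, u i • x i = 0 ∧ u ≠ 0 ∧ hammingNorm u ≤ 3 := by
  classical
  simp only [IsCap] at h
  push Not at h
  obtain ⟨i, j, k, hij, hik, hjk, a, b, c, habc, hne⟩ := h
  set u : Fin m → ZMod p := Pi.single i a + Pi.single j b + Pi.single k c with hu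
  have hui : u i = a := by simp [hu, hij, hik]
  have huj : u j = b := by simp [hu, hij.symm, hjk]
  have huk : u k = c := by simp [hu, hik.symm, hjk.symm]
  refine ⟨u, ?_, fun h0 => ?_, ?_⟩
  · simp only [hu, Pi.add_apply, add_smul, Finset.sum_add_distrib]
    simp only [Pi.single_apply, ite_smul, zero_smul, Finset.sum_ite_eq', Finset.mem_univ, if_true]
    exact habc
  · rw [h0] at hui huj huk
    exact hne hui.symm huj.symm huk.symm
  · refine (Finset.card_le_card (t := {i, j, k}) fun l hl => ?_).trans Finset.card_le_three
    by_contra hl'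
    simp only [Finset.mem_insert, Finset.mem_singleton, not_or] at hl'
    simp [hu, hl'.1, hl'.2.1, hl'.2.2] at hl

/-- Points in a subspace of dimension less than their number satisfy a linear relation. -/
theorem exists_relation_of_finrank_lt (T : Finset (Fin m)) (W : Submodule (ZMod p) V)
    [FiniteDimensional (ZMod p) W] (hW : finrank (ZMod p) W < T.card) (hT : ∀ i ∈ T, x i ∈ W) :
    ∃ u : Fin m → ZMod p, ∑ i, u i • x i = 0 ∧ u ≠ 0 ∧ hammingNorm u ≤ T.card := by
  classical
  have hdep : ¬ LinearIndependent (ZMod p) fun i : T => (⟨x i, hT i i.2⟩ : W) := fun h => by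
    have := h.fintype_card_le_finrank
    rw [Fintype.card_coe] at this
    omega
  obtain ⟨g, hg, i, hi⟩ := Fintype.not_linearIndependent_iff.1 hdep
  have hg' : ∑ i : T, g i • x i = 0 := by
    have := congrArg (W.subtype) hg
    simpa using this
  set u : Fin m → ZMod p := fun i => if h : i ∈ T then g ⟨i, h⟩ else 0 with hu
  refine ⟨u, ?_, fun h0 => hi ?_, Finset.card_le_card fun l hl => ?_⟩
  · rw [← hg', ← Finset.sum_subset (Finset.subset_univ T) fun i _ hi => by simp [hu, hi],
      ← Finset.sum_coe_sort T]
    exact Finset.sum_congr rfl fun i _ => by simp [hu]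
  · have := congrFun h0 i
    simpa [hu] using this
  · by_contra hl'
    simp [hu, hl'] at hl

theorem hasMinDist_three {B : LinearMap.BilinForm (ZMod p) V} (hB : B.Nondegenerate)
    (hx : PairwiseIndep (p := p) x) (hne : ∀ i, x i ≠ 0) (hcap : ¬ IsCap (p := p) x) :
    HasMinDist (dualCode (definingSetCode B x)) 3 := by
  refine hasMinDist_of_hammingNorm
    (fun u hu hu0 => hx.three_le_hammingNorm hne ((mem_dualCode_iff hB).1 hu) hu0) ?_
  obtain ⟨u, hu, hu0, hu3⟩ := exists_hammingNorm_le_three_of_not_isCap hcap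
  exact ⟨u, (mem_dualCode_iff hB).2 hu, hu0, hu3⟩

/-- A cap with four coplanar points. -/
theorem hasMinDist_four [FiniteDimensional (ZMod p) V] {B : LinearMap.BilinForm (ZMod p) V}
    (hB : B.Nondegenerate)
    (hx : PairwiseIndep (p := p) x) (hne : ∀ i, x i ≠ 0) (hcap : IsCap (p := p) x)
    (T : Finset (Fin m)) (W : Submodule (ZMod p) V) (hW : finrank (ZMod p) W ≤ 3)
    (hT4 : 4 ≤ T.card) (hT : ∀ i ∈ T, x i ∈ W) :
    HasMinDist (dualCode (definingSetCode B x)) 4 := by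
  refine hasMinDist_of_hammingNorm
    (fun u hu hu0 => hcap.four_le_hammingNorm hx hne ((mem_dualCode_iff hB).1 hu) hu0) ?_
  obtain ⟨T', hT', hcard⟩ := Finset.exists_subset_card_eq hT4
  obtain ⟨u, hu, hu0, hu4⟩ := exists_relation_of_finrank_lt T' W (by omega)
    fun i hi => hT i (hT' hi)
  exact ⟨u, (mem_dualCode_iff hB).2 hu, hu0, hcard ▸ hu4⟩

end Codes

/-! ### Plane sections of caps in odd characteristic. -/

section Caps

open Module

variable {p : ℕ} [hp : Fact p.Prime] {V : Type*} [AddCommGroup V] [Module (ZMod p) V]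
  {m : ℕ} {x : Fin m → V}

/-- Such values exhaust the non-zero residues, so this is Wilson's theorem. -/
theorem prod_eq_neg_one_of_injOn {ι : Type*} (J : Finset ι) (r : ι → ZMod p)
    (hr : Set.InjOn r J) (h0 : ∀ i ∈ J, r i ≠ 0) (hJ : J.card = p - 1) :
    ∏ i ∈ J, r i = -1 := by
  classical
  have himg : J.image r = Finset.univ.erase 0 := by
    refine Finset.eq_of_subset_of_card_le ?_ ?_
    · intro a ha
      obtain ⟨i, hi, rfl⟩ := Finset.mem_image.1 ha
      exact Finset.mem_erase.2 ⟨h0 i hi, Finset.mem_univ _⟩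
    · rw [Finset.card_erase_of_mem (Finset.mem_univ _), Finset.card_univ, ZMod.card,
        Finset.card_image_of_injOn hr, hJ]
  rw [← Finset.prod_image (f := fun a => a) (fun i hi j hj h => hr hi hj h), himg]
  have h := FiniteField.prod_univ_units_id_eq_neg_one (K := ZMod p)
  have h' := congrArg (Units.coeHom (ZMod p)) h
  rw [map_prod] at h'
  simp only [Units.coeHom_apply, Units.val_neg, Units.val_one] at h'
  rw [← h']
  symm
  refine Finset.prod_bij (fun a _ => (a : ZMod p)) (fun a _ => by simp) (fun a _ b _ h => Units.ext h)
    (fun b hb => ⟨Units.mk0 b (Finset.ne_of_mem_erase hb), Finset.mem_univ _, rfl⟩)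
    fun a _ => rfl

/-- In odd characteristic, a cap in the plane through `x i₀`, `x i₁` and `y` has at most
`p - 1` points other than `x i₀` and `x i₁`. -/
theorem IsCap.card_le_of_coplanar (hp2 : p ≠ 2) (hcap : IsCap (p := p) x) {i₀ i₁ : Fin m}
    (h01 : i₀ ≠ i₁) (y : V) (J : Finset (Fin m)) (h0 : i₀ ∉ J) (h1 : i₁ ∉ J)
    (hJ : ∀ i ∈ J, ∃ a b c : ZMod p, x i = a • x i₀ + b • x i₁ + c • y) : J.card ≤ p - 1 := by
  classical
  have hne0 : ∀ i ∈ J, i ≠ i₀ := fun i hi h => h0 (h ▸ hi)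
  have hne1 : ∀ i ∈ J, i ≠ i₁ := fun i hi h => h1 (h ▸ hi)
  -- Affine coordinates `(A, Y)` with `x i₀` and `x i₁` at infinity. The coefficient of `y` is
  -- non-zero, since otherwise `x i` would be on the line of these two points.
  have hnorm : ∀ i, ∃ A Y c : ZMod p, i ∈ J → c ≠ 0 ∧ c • x i = A • x i₀ + Y • x i₁ + y := by
    intro i
    by_cases hi : i ∈ J
    · obtain ⟨a, b, c, habc⟩ := hJ i hi
      have hc : c ≠ 0 := by
        rintro rfl
        have := hcap i i₀ i₁ (hne0 i hi) (hne1 i hi) h01 1 (-a) (-b) (by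
          rw [habc]; module)
        exact one_ne_zero this.1
      refine ⟨c⁻¹ * a, c⁻¹ * b, c⁻¹, fun _ => ⟨inv_ne_zero hc, ?_⟩⟩
      rw [habc, smul_add, smul_add, smul_smul, smul_smul, smul_smul, inv_mul_cancel₀ hc, one_smul]
    · exact ⟨0, 0, 0, fun h => absurd h hi⟩
  choose A Y c hc using hnorm
  have hA : ∀ i ∈ J, ∀ j ∈ J, A i = A j → i = j := by
    intro i hi j hj h
    by_contra hij
    have := hcap i j i₁ hij (hne1 i hi) (hne1 j hj) (c i) (-c j) (-(Y i - Y j)) (by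
      rw [neg_smul, (hc i hi).2, (hc j hj).2, h]; module)
    exact (hc i hi).1 this.1
  have hY : ∀ i ∈ J, ∀ j ∈ J, Y i = Y j → i = j := by
    intro i hi j hj h
    by_contra hij
    have := hcap i j i₀ hij (hne0 i hi) (hne0 j hj) (c i) (-c j) (-(A i - A j)) (by
      rw [neg_smul, (hc i hi).2, (hc j hj).2, h]; module)
    exact (hc i hi).1 this.1
  by_contra hlt
  have hle : J.card ≤ p := by
    have := Finset.card_le_card_of_injOn (t := (Finset.univ : Finset (ZMod p))) A
      (fun _ _ => Finset.mem_univ _) (fun i hi j hj h => hA i hi j hj h)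
    rwa [Finset.card_univ, ZMod.card] at this
  have hcard : J.card = p := by omega
  -- With `p` points, the differences of `A` from point `k`, those of `Y`, and the slopes through
  -- `k` would each run over all non-zero residues, as no three points are collinear. All three
  -- products are `-1`, yet the third is the quotient of the first two, so `-1 = 1`.
  obtain ⟨k, hk⟩ : J.Nonempty := Finset.card_pos.1 (by rw [hcard]; exact hp.out.pos)
  have hcard' : (J.erase k).card = p - 1 := by rw [Finset.card_erase_of_mem hk, hcard]
  have hmem : ∀ i ∈ J.erase k, i ∈ J ∧ i ≠ k := fun i hi =>
    ⟨Finset.mem_of_mem_erase hi, Finset.ne_of_mem_erase hi⟩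
  have hA0 : ∀ i ∈ J.erase k, A i - A k ≠ 0 := fun i hi h =>
    (hmem i hi).2 (hA i (hmem i hi).1 k hk (sub_eq_zero.1 h))
  have hY0 : ∀ i ∈ J.erase k, Y i - Y k ≠ 0 := fun i hi h =>
    (hmem i hi).2 (hY i (hmem i hi).1 k hk (sub_eq_zero.1 h))
  have pA := prod_eq_neg_one_of_injOn (J.erase k) (fun i => A i - A k)
    (fun i hi j hj h => hA i (hmem i hi).1 j (hmem j hj).1 (sub_left_injective h)) hA0 hcard'
  have pY := prod_eq_neg_one_of_injOn (J.erase k) (fun i => Y i - Y k)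
    (fun i hi j hj h => hY i (hmem i hi).1 j (hmem j hj).1 (sub_left_injective h)) hY0 hcard'
  have pR := prod_eq_neg_one_of_injOn (J.erase k) (fun i => (A i - A k) / (Y i - Y k))
    (fun i hi j hj h => by
      have hi' := hmem i hi
      have hj' := hmem j hj
      by_contra hij
      have hdet : (A i - A k) * (Y j - Y k) = (A j - A k) * (Y i - Y k) :=
        (div_eq_div_iff (hY0 i hi) (hY0 j hj)).1 h
      have := hcap i j k hij hi'.2 hj'.2 ((A j - A k) * c i) (-((A i - A k) * c j))
        (-((A j - A k) - (A i - A k)) * c k) (by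
          rw [neg_smul, mul_smul, mul_smul, mul_smul, (hc i hi'.1).2, (hc j hj'.1).2, (hc k hk).2]
          have hz : ((A j - A k) * (Y i - Y k) - (A i - A k) * (Y j - Y k)) • x i₁ = 0 := by
            rw [hdet, sub_self, zero_smul]
          rw [← hz]; module)
      exact mul_ne_zero (hA0 j hj) (hc i hi'.1).1 this.1)
    (fun i hi => div_ne_zero (hA0 i hi) (hY0 i hi)) hcard'
  rw [Finset.prod_div_distrib, pA, pY, div_self (neg_ne_zero.2 one_ne_zero)] at pR
  have h2 : ((2 : ℕ) : ZMod p) = 0 := by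
    have : (1 : ZMod p) + 1 = 0 := by nth_rewrite 1 [pR]; ring
    push_cast; rw [← this]; norm_num
  rw [ZMod.natCast_eq_zero_iff] at h2
  exact hp2 ((Nat.prime_dvd_prime_iff_eq hp.out Nat.prime_two).1 h2)

end Caps

/-! ### The cap bound and ovoids. -/

section CapBound

open Module

variable {p : ℕ} [hp : Fact p.Prime] {V : Type*} [AddCommGroup V] [Module (ZMod p) V] [Fintype V]
  {m : ℕ} {x : Fin m → V}

omit [Fintype V] in
theorem PairwiseIndep.finrank_span_pair (hx : PairwiseIndep (p := p) x) {i j : Fin m}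
    (hij : i ≠ j) : finrank (ZMod p) (Submodule.span (ZMod p) {x i, x j}) = 2 := by
  have h : LinearIndependent (ZMod p) ![x i, x j] :=
    LinearIndependent.pair_iff.2 fun a b hab => hx i j hij a b hab
  have hr : Set.range ![x i, x j] = {x i, x j} := by
    ext v; simp [or_comm]
  rw [← hr, finrank_span_eq_card h, Fintype.card_fin]

omit [Fintype V] in
theorem mem_span_of_smul_mkQ_eq {i₀ i₁ i : Fin m} {y : V} {c : ZMod p} (hc : c ≠ 0)
    (h : c • (Submodule.span (ZMod p) {x i₀, x i₁}).mkQ (x i) =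
      (Submodule.span (ZMod p) {x i₀, x i₁}).mkQ y) :
    ∃ a b c : ZMod p, x i = a • x i₀ + b • x i₁ + c • y := by
  rw [← map_smul, ← sub_eq_zero, ← map_sub, Submodule.mkQ_apply,
    Submodule.Quotient.mk_eq_zero, Submodule.mem_span_pair] at h
  obtain ⟨a, b, hab⟩ := h
  refine ⟨c⁻¹ * a, c⁻¹ * b, c⁻¹, ?_⟩
  rw [mul_smul, mul_smul, ← smul_add, ← smul_add, hab, sub_add_cancel, smul_smul,
    inv_mul_cancel₀ hc, one_smul]

open scoped Classical in
/-- The points other than `x i₀` and `x i₁` in the plane through these two and `y`. -/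
noncomputable def planePoints (x : Fin m → V) (i₀ i₁ : Fin m)
    (q : V ⧸ Submodule.span (ZMod p) {x i₀, x i₁}) : Finset (Fin m) :=
  Finset.univ.filter fun i => i ≠ i₀ ∧ i ≠ i₁ ∧
    ∃ c : ZMod p, c • (Submodule.span (ZMod p) {x i₀, x i₁}).mkQ (x i) = q

omit [Fintype V] in
theorem mem_planePoints {i₀ i₁ i : Fin m} {q : V ⧸ Submodule.span (ZMod p) {x i₀, x i₁}} :
    i ∈ planePoints x i₀ i₁ q ↔ i ≠ i₀ ∧ i ≠ i₁ ∧
      ∃ c : ZMod p, c • (Submodule.span (ZMod p) {x i₀, x i₁}).mkQ (x i) = q := by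
  classical
  simp only [planePoints, Finset.mem_filter, Finset.mem_univ, true_and]

omit [Fintype V] in
theorem exists_of_mem_planePoints {i₀ i₁ i : Fin m} {y : V}
    (hy : (Submodule.span (ZMod p) {x i₀, x i₁}).mkQ y ≠ 0)
    (hi : i ∈ planePoints x i₀ i₁ ((Submodule.span (ZMod p) {x i₀, x i₁}).mkQ y)) :
    ∃ a b c : ZMod p, x i = a • x i₀ + b • x i₁ + c • y := by
  obtain ⟨-, -, c, hc⟩ := mem_planePoints.1 hi
  refine mem_span_of_smul_mkQ_eq (c := c) ?_ hc
  rintro rfl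
  rw [zero_smul] at hc
  exact hy hc.symm

omit [Fintype V] in
theorem IsCap.card_planePoints_le (hp2 : p ≠ 2) (hcap : IsCap (p := p) x) {i₀ i₁ : Fin m}
    (h01 : i₀ ≠ i₁) {q : V ⧸ Submodule.span (ZMod p) {x i₀, x i₁}} (hq : q ≠ 0) :
    (planePoints x i₀ i₁ q).card ≤ p - 1 := by
  obtain ⟨y, rfl⟩ := Submodule.mkQ_surjective _ q
  exact hcap.card_le_of_coplanar hp2 h01 y _ (by simp [mem_planePoints]) (by simp [mem_planePoints])
    fun i hi => exists_of_mem_planePoints hq hi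

-- No further point of a cap is on the line through the first two, so each has a non-zero image in
-- the quotient, whose `p - 1` non-zero multiples are the classes `q` that count it. Each plane
-- through the line is represented by `p - 1` classes.
omit [Fintype V] in
open scoped Classical in
theorem IsCap.sum_card_planePoints (hcap : IsCap (p := p) x) {i₀ i₁ : Fin m} (h01 : i₀ ≠ i₁)
    [Fintype (V ⧸ Submodule.span (ZMod p) {x i₀, x i₁})] :
    ∑ q ∈ (Finset.univ : Finset (V ⧸ Submodule.span (ZMod p) {x i₀, x i₁})).erase 0,
      (planePoints x i₀ i₁ q).card = (m - 2) * (p - 1) := by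
  set π := (Submodule.span (ZMod p) {x i₀, x i₁}).mkQ with hπ
  set T : Finset (Fin m) := (Finset.univ.erase i₀).erase i₁ with hT
  have hTcard : T.card = m - 2 := by
    rw [hT, Finset.card_erase_of_mem (by simp [h01.symm]),
      Finset.card_erase_of_mem (Finset.mem_univ _), Finset.card_univ, Fintype.card_fin]
    omega
  have hne : ∀ i ∈ T, π (x i) ≠ 0 := by
    intro i hi h0
    simp only [hT, Finset.mem_erase, Finset.mem_univ, and_true] at hi
    rw [hπ, Submodule.mkQ_apply, Submodule.Quotient.mk_eq_zero, Submodule.mem_span_pair] at h0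
    obtain ⟨a, b, hab⟩ := h0
    have := hcap i i₀ i₁ hi.2 hi.1 h01 1 (-a) (-b) (by rw [← hab]; module)
    exact one_ne_zero this.1
  have hswap : ∑ q ∈ (Finset.univ : Finset (V ⧸ Submodule.span (ZMod p) {x i₀, x i₁})).erase 0,
      (planePoints x i₀ i₁ q).card =
      ∑ i ∈ T, ((Finset.univ.erase 0).filter fun q => ∃ c : ZMod p, c • π (x i) = q).card := by
    have : ∀ q, planePoints x i₀ i₁ q = T.filter fun i => ∃ c : ZMod p, c • π (x i) = q := by
      intro q; ext i
      simp only [mem_planePoints, hT, Finset.mem_filter, Finset.mem_erase, Finset.mem_univ,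
        and_true, hπ]
      tauto
    simp only [this, Finset.card_filter]
    exact Finset.sum_comm
  rw [hswap, ← hTcard, ← smul_eq_mul, ← Finset.sum_const]
  refine Finset.sum_congr rfl fun i hi => ?_
  have himg : (Finset.univ.erase 0).filter (fun q => ∃ c : ZMod p, c • π (x i) = q) =
      (Finset.univ.erase (0 : ZMod p)).image fun c => c • π (x i) := by
    ext q
    simp only [Finset.mem_filter, Finset.mem_erase, Finset.mem_univ, and_true, Finset.mem_image]
    constructor
    · rintro ⟨hq, c, rfl⟩
      exact ⟨c, fun h => hq (by rw [h, zero_smul]), rfl⟩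
    · rintro ⟨c, hc, rfl⟩
      exact ⟨smul_ne_zero hc (hne i hi), c, rfl⟩
  rw [himg, Finset.card_image_of_injective _ (smul_left_injective _ (hne i hi)),
    Finset.card_erase_of_mem (Finset.mem_univ _), Finset.card_univ, ZMod.card]

theorem PairwiseIndep.card_quotient (hx : PairwiseIndep (p := p) x) {i₀ i₁ : Fin m}
    (h01 : i₀ ≠ i₁) [Fintype (V ⧸ Submodule.span (ZMod p) {x i₀, x i₁})] :
    Fintype.card (V ⧸ Submodule.span (ZMod p) {x i₀, x i₁}) = p ^ (finrank (ZMod p) V - 2) := by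
  have h := Submodule.finrank_quotient_add_finrank (Submodule.span (ZMod p) {x i₀, x i₁})
  rw [hx.finrank_span_pair h01] at h
  rw [card_eq_pow_finrank_zmod (p := p), ← h, Nat.add_sub_cancel]

/-- The cap bound in odd characteristic. -/
theorem IsCap.card_le (hp2 : p ≠ 2) (hx : PairwiseIndep (p := p) x) (hcap : IsCap (p := p) x) :
    m ≤ p ^ (finrank (ZMod p) V - 2) + 1 := by
  classical
  rcases Nat.lt_or_ge m 2 with hm | hm
  · have := Nat.one_le_pow (finrank (ZMod p) V - 2) p hp.out.pos
    omega
  set i₀ : Fin m := ⟨0, by omega⟩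
  set i₁ : Fin m := ⟨1, by omega⟩
  have h01 : i₀ ≠ i₁ := by simp [i₀, i₁]
  have : Fintype (V ⧸ Submodule.span (ZMod p) {x i₀, x i₁}) := Fintype.ofFinite _
  have h := hcap.sum_card_planePoints h01
  -- There are `p ^ (n - 2) - 1` non-zero classes, with at most `p - 1` points each, against a total
  -- of `(m - 2) * (p - 1)`.
  have hle := Finset.sum_le_card_nsmul
    ((Finset.univ : Finset (V ⧸ Submodule.span (ZMod p) {x i₀, x i₁})).erase 0) _ _
    fun q hq => hcap.card_planePoints_le hp2 h01 (Finset.ne_of_mem_erase hq)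
  rw [h, Finset.card_erase_of_mem (Finset.mem_univ _), Finset.card_univ, hx.card_quotient h01,
    smul_eq_mul] at hle
  have h1 : m - 2 ≤ p ^ (finrank (ZMod p) V - 2) - 1 :=
    Nat.le_of_mul_le_mul_right hle (by have := hp.out.two_le; omega)
  have h2 := Nat.one_le_pow (finrank (ZMod p) V - 2) p hp.out.pos
  omega

/-- A plane meeting an ovoid of a three-dimensional projective space in at least two points
meets it in `p + 1` points. -/
theorem IsCap.card_hyperplane_eq (hp2 : p ≠ 2) (hx : PairwiseIndep (p := p) x)
    (hcap : IsCap (p := p) x) {B : LinearMap.BilinForm (ZMod p) V} (hB : B.Nondegenerate)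
    (hn : finrank (ZMod p) V = 4) (hm : m = p ^ 2 + 1) {α : V} (hα : α ≠ 0)
    (h2 : 2 ≤ (Finset.univ.filter fun i => B α (x i) = 0).card) :
    (Finset.univ.filter fun i => B α (x i) = 0).card = p + 1 := by
  classical
  obtain ⟨i₀, hi₀, i₁, hi₁, h01⟩ := Finset.one_lt_card.1 h2
  have hi₀' := (Finset.mem_filter.1 hi₀).2
  have hi₁' := (Finset.mem_filter.1 hi₁).2
  set L := Submodule.span (ZMod p) {x i₀, x i₁} with hL
  have hLrank : finrank (ZMod p) L = 2 := hx.finrank_span_pair h01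
  have hker : finrank (ZMod p) (LinearMap.ker (B α)) = 3 := by
    have := finrank_ker_bilin hB hα; omega
  have hLle : L ≤ LinearMap.ker (B α) := by
    rw [hL, Submodule.span_le]
    rintro v (rfl | rfl)
    · exact hi₀'
    · exact hi₁'
  obtain ⟨y, hyker, hyL⟩ : ∃ y ∈ LinearMap.ker (B α), y ∉ L := by
    by_contra! h
    have := Submodule.finrank_mono (show LinearMap.ker (B α) ≤ L from h)
    omega
  have hy : L.mkQ y ≠ 0 := by
    rwa [Submodule.mkQ_apply, Ne, Submodule.Quotient.mk_eq_zero]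
  have : Fintype (V ⧸ L) := Fintype.ofFinite _
  -- With `m = p ^ 2 + 1` the averaging behind the cap bound is tight, so each plane through the
  -- line has exactly `p - 1` further points.
  have hfib : (planePoints x i₀ i₁ (L.mkQ y)).card = p - 1 := by
    have h := hcap.sum_card_planePoints h01
    have hQ : ((Finset.univ : Finset (V ⧸ L)).erase 0).card = m - 2 := by
      rw [Finset.card_erase_of_mem (Finset.mem_univ _), Finset.card_univ, hx.card_quotient h01,
        hn, hm]
      change p ^ 2 - 1 = p ^ 2 + 1 - 2
      omega
    have hle : ∀ q ∈ (Finset.univ : Finset (V ⧸ L)).erase 0,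
        (planePoints x i₀ i₁ q).card ≤ p - 1 :=
      fun q hq => hcap.card_planePoints_le hp2 h01 (Finset.ne_of_mem_erase hq)
    refine (Finset.sum_eq_sum_iff_of_le hle).1 ?_ _ (Finset.mem_erase.2 ⟨hy, Finset.mem_univ _⟩)
    rw [Finset.sum_const, hQ, smul_eq_mul, ← h]
  have hsup : L ⊔ Submodule.span (ZMod p) {y} = LinearMap.ker (B α) := by
    refine Submodule.eq_of_le_of_finrank_le
      (sup_le hLle ((Submodule.span_singleton_le_iff_mem _ _).2 hyker)) ?_
    have hlt : L < L ⊔ Submodule.span (ZMod p) {y} := by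
      refine lt_of_le_of_ne le_sup_left fun h => hyL ?_
      rw [h]
      exact Submodule.mem_sup_right (Submodule.mem_span_singleton_self y)
    have := Submodule.finrank_lt_finrank_of_lt hlt
    omega
  set H := Finset.univ.filter fun i => B α (x i) = 0 with hH
  have hHcard : ((H.erase i₀).erase i₁).card = H.card - 2 := by
    rw [Finset.card_erase_of_mem (Finset.mem_erase.2 ⟨h01.symm, hi₁⟩),
      Finset.card_erase_of_mem hi₀]
    omega
  have hge : p - 1 ≤ H.card - 2 := by
    rw [← hHcard, ← hfib]
    refine Finset.card_le_card fun i hi => ?_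
    obtain ⟨a, b, c, habc⟩ := exists_of_mem_planePoints hy hi
    obtain ⟨hne0, hne1, -⟩ := mem_planePoints.1 hi
    refine Finset.mem_erase.2 ⟨hne1, Finset.mem_erase.2 ⟨hne0, ?_⟩⟩
    rw [hH, Finset.mem_filter]
    refine ⟨Finset.mem_univ _, ?_⟩
    rw [habc, map_add, map_add, map_smul, map_smul, map_smul, hi₀', hi₁',
      LinearMap.mem_ker.1 hyker]
    simp
  have hle : H.card - 2 ≤ p - 1 := by
    rw [← hHcard]
    refine hcap.card_le_of_coplanar hp2 h01 y _ (by simp) (by simp) fun i hi => ?_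
    have hi' : x i ∈ LinearMap.ker (B α) :=
      (Finset.mem_filter.1 (Finset.mem_of_mem_erase (Finset.mem_of_mem_erase hi))).2
    rw [← hsup, Submodule.mem_sup] at hi'
    obtain ⟨l, hl, z, hz, hlz⟩ := hi'
    obtain ⟨a, b, rfl⟩ := Submodule.mem_span_pair.1 hl
    obtain ⟨c, rfl⟩ := Submodule.mem_span_singleton.1 hz
    exact ⟨a, b, c, hlz.symm⟩
  have := hp.out.two_le
  omega

/-- Fewer than `n` linear conditions have a non-zero common solution. -/
theorem exists_ne_zero_bilin_eq_zero (B : LinearMap.BilinForm (ZMod p) V) {k : ℕ} (v : Fin k → V)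
    (hk : k < finrank (ZMod p) V) : ∃ α : V, α ≠ 0 ∧ ∀ i, B α (v i) = 0 := by
  set T : V →ₗ[ZMod p] Fin k → ZMod p := LinearMap.pi fun i => B.flip (v i) with hT
  have hne : LinearMap.ker T ≠ ⊥ := LinearMap.ker_ne_bot_of_finrank_lt (by simpa using hk)
  obtain ⟨α, hα, hα0⟩ := Submodule.exists_mem_ne_zero_of_ne_bot hne
  refine ⟨α, hα0, fun i => ?_⟩
  have := congrFun (LinearMap.mem_ker.1 hα) i
  simpa [hT] using this

omit [Fintype V] in
/-- The third point of a trisecant lies on every hyperplane through the other two. -/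
theorem PairwiseIndep.exists_trisecant_of_not_isCap (hx : PairwiseIndep (p := p) x)
    (hcap : ¬ IsCap (p := p) x) :
    ∃ i j k, i ≠ j ∧ i ≠ k ∧ j ≠ k ∧ ∀ φ : V →ₗ[ZMod p] ZMod p, φ (x i) = 0 → φ (x j) = 0 →
      φ (x k) = 0 := by
  simp only [IsCap] at hcap
  push Not at hcap
  obtain ⟨i, j, k, hij, hik, hjk, a, b, c, habc, hne⟩ := hcap
  refine ⟨i, j, k, hij, hik, hjk, fun φ hi hj => ?_⟩
  have hc : c ≠ 0 := by
    rintro rfl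
    rw [zero_smul, add_zero] at habc
    obtain ⟨ha, hb⟩ := hx i j hij a b habc
    exact hne ha hb rfl
  have := congrArg φ habc
  rw [map_add, map_add, map_smul, map_smul, map_smul, hi, hj, map_zero] at this
  simpa [hc] using this

/-- In a projective plane a trisecant is itself a hyperplane `α^⊥`, and it would hold three points.
-/
theorem PairwiseIndep.isCap_of_finrank_eq_three (hx : PairwiseIndep (p := p) x)
    {B : LinearMap.BilinForm (ZMod p) V} (hn : finrank (ZMod p) V = 3)
    (h : ∀ α : V, α ≠ 0 → (Finset.univ.filter fun i => B α (x i) = 0).card ≤ 2) :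
    IsCap (p := p) x := by
  classical
  by_contra hcap
  obtain ⟨i, j, k, hij, hik, hjk, hφ⟩ := hx.exists_trisecant_of_not_isCap hcap
  obtain ⟨α, hα, h0⟩ := exists_ne_zero_bilin_eq_zero B ![x i, x j] (by omega)
  have hi : B α (x i) = 0 := h0 0
  have hj : B α (x j) = 0 := h0 1
  have hk := hφ (B α) hi hj
  have hsub : ({i, j, k} : Finset (Fin m)) ⊆ Finset.univ.filter fun i => B α (x i) = 0 := by
    intro l hl
    simp only [Finset.mem_insert, Finset.mem_singleton] at hl
    rcases hl with rfl | rfl | rfl <;> simp [hi, hj, hk]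
  have h3 := Finset.card_le_card hsub
  rw [Finset.card_eq_three.2 ⟨i, j, k, hij, hik, hjk, rfl⟩] at h3
  have := h α hα
  omega

/-- A set of `p ^ 2 + 1` points of a three-dimensional projective space meeting each plane in
`1` or `p + 1` points is an ovoid. -/
theorem PairwiseIndep.isCap_of_finrank_eq_four (hx : PairwiseIndep (p := p) x)
    {B : LinearMap.BilinForm (ZMod p) V} (hB : B.Nondegenerate) (hsymm : B.IsSymm)
    (hn : finrank (ZMod p) V = 4) (hm : m = p ^ 2 + 1)
    (h : ∀ α : V, α ≠ 0 → 2 ≤ (Finset.univ.filter fun i => B α (x i) = 0).card →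
      (Finset.univ.filter fun i => B α (x i) = 0).card = p + 1) :
    IsCap (p := p) x := by
  classical
  by_contra hcap
  obtain ⟨i, j, k, hij, hik, hjk, hφ⟩ := hx.exists_trisecant_of_not_isCap hcap
  -- Assuming a trisecant, `A` parametrises the planes through it. Incidences of the points with
  -- these planes are counted twice.
  set A := B.orthogonal (Submodule.span (ZMod p) {x i, x j}) with hA
  have hArank : finrank (ZMod p) A = 2 := by
    rw [hA, LinearMap.BilinForm.finrank_orthogonal hB, hx.finrank_span_pair hij, hn]
  have hAmem : ∀ α ∈ A, B α (x i) = 0 ∧ B α (x j) = 0 := by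
    intro α hα
    rw [hA, LinearMap.BilinForm.mem_orthogonal_iff] at hα
    exact ⟨by rw [hsymm.eq]; exact hα _ (Submodule.subset_span (by simp)),
      by rw [hsymm.eq]; exact hα _ (Submodule.subset_span (by simp))⟩
  have hAcard : (Finset.univ.filter (· ∈ A)).card = p ^ 2 := by rw [card_filter_mem, hArank]
  set A₀ := (Finset.univ.filter (· ∈ A)).erase 0 with hA₀
  have hA₀card : A₀.card = p ^ 2 - 1 := by
    rw [hA₀, Finset.card_erase_of_mem (by simp), hAcard]
  have hA₀mem : ∀ α ∈ A₀, α ≠ 0 ∧ α ∈ A := fun α hα =>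
    ⟨Finset.ne_of_mem_erase hα, (Finset.mem_filter.1 (Finset.mem_of_mem_erase hα)).2⟩
  have hijk : ∀ α ∈ A₀, ∀ l ∈ ({i, j, k} : Finset (Fin m)), B α (x l) = 0 := by
    intro α hα l hl
    obtain ⟨h1, h2⟩ := hAmem α (hA₀mem α hα).2
    simp only [Finset.mem_insert, Finset.mem_singleton] at hl
    rcases hl with rfl | rfl | rfl
    · exact h1
    · exact h2
    · exact hφ _ h1 h2
  have h3card : ({i, j, k} : Finset (Fin m)).card = 3 :=
    Finset.card_eq_three.2 ⟨i, j, k, hij, hik, hjk, rfl⟩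
  have hsum : ∑ α ∈ A₀, (Finset.univ.filter fun l => B α (x l) = 0).card =
      (p ^ 2 - 1) * (p + 1) := by
    rw [← hA₀card, ← smul_eq_mul, ← Finset.sum_const]
    refine Finset.sum_congr rfl fun α hα => h α (hA₀mem α hα).1 ?_
    have : ({i, j, k} : Finset (Fin m)) ⊆ Finset.univ.filter fun l => B α (x l) = 0 :=
      fun l hl => Finset.mem_filter.2 ⟨Finset.mem_univ _, hijk α hα l hl⟩
    have := Finset.card_le_card this
    omega
  have hswap : ∑ α ∈ A₀, (Finset.univ.filter fun l => B α (x l) = 0).card =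
      ∑ l, (A₀.filter fun α => B α (x l) = 0).card := by
    simp only [Finset.card_filter]
    exact Finset.sum_comm
  have hin : ∀ l ∈ ({i, j, k} : Finset (Fin m)),
      (A₀.filter fun α => B α (x l) = 0).card = p ^ 2 - 1 := by
    intro l hl
    rw [Finset.filter_true_of_mem fun α hα => hijk α hα l hl, hA₀card]
  -- One linear condition on the two-dimensional `A` leaves at least a line, hence `p - 1` non-zero
  -- vectors.
  have hout : ∀ l, p - 1 ≤ (A₀.filter fun α => B α (x l) = 0).card := by
    intro l
    set W := A ⊓ LinearMap.ker (B.flip (x l)) with hW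
    have hWrank : 1 ≤ finrank (ZMod p) W := by
      have h1 := Submodule.finrank_sup_add_finrank_inf_eq A (LinearMap.ker (B.flip (x l)))
      have h2 := LinearMap.finrank_range_add_finrank_ker (B.flip (x l))
      have h3 : finrank (ZMod p) (LinearMap.range (B.flip (x l))) ≤ 1 := by
        have := Submodule.finrank_le (LinearMap.range (B.flip (x l)))
        rwa [finrank_self] at this
      have h4 := Submodule.finrank_le (A ⊔ LinearMap.ker (B.flip (x l)))
      rw [← hW] at h1
      omega
    have hWcard : p ≤ (Finset.univ.filter (· ∈ W)).card := by
      rw [card_filter_mem]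
      exact Nat.le_self_pow (by omega) p
    have hsub : (Finset.univ.filter (· ∈ W)).erase 0 ⊆ A₀.filter fun α => B α (x l) = 0 := by
      intro α hα
      obtain ⟨h1, h2⟩ := Finset.mem_erase.1 hα
      have h3 := (Finset.mem_filter.1 h2).2
      exact Finset.mem_filter.2 ⟨Finset.mem_erase.2 ⟨h1, by simpa using h3.1⟩,
        by simpa using h3.2⟩
    have := Finset.card_le_card hsub
    rw [Finset.card_erase_of_mem (by simp)] at this
    omega
  have hlower : 3 * (p ^ 2 - 1) + (p ^ 2 - 2) * (p - 1) ≤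
      ∑ l, (A₀.filter fun α => B α (x l) = 0).card := by
    rw [← Finset.sum_add_sum_compl ({i, j, k} : Finset (Fin m))]
    refine add_le_add ?_ ?_
    · rw [Finset.sum_congr rfl hin, Finset.sum_const, h3card, smul_eq_mul]
    · have hcompl : (({i, j, k} : Finset (Fin m))ᶜ).card = p ^ 2 - 2 := by
        rw [Finset.card_compl, h3card, Fintype.card_fin, hm]; omega
      rw [← hcompl, ← smul_eq_mul]
      exact Finset.card_nsmul_le_sum _ _ _ fun l _ => hout l
  rw [← hswap, hsum] at hlower
  -- The lower bound exceeds `(p ^ 2 - 1) * (p + 1)` by `p ^ 2 - p`. Writing `p = q + 2` clears the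
  -- truncated subtractions.
  obtain ⟨q, rfl⟩ : ∃ q, p = q + 2 := ⟨p - 2, by have := hp.out.two_le; omega⟩
  have e1 : (q + 2) ^ 2 - 1 = (q + 1) * (q + 3) := by
    rw [show (q + 2) ^ 2 = (q + 1) * (q + 3) + 1 by ring, Nat.add_sub_cancel]
  have e2 : (q + 2) ^ 2 - 2 = q ^ 2 + 4 * q + 2 := by
    rw [show (q + 2) ^ 2 = q ^ 2 + 4 * q + 2 + 2 by ring, Nat.add_sub_cancel]
  rw [e1, e2, show q + 2 - 1 = q + 1 by omega] at hlower
  nlinarith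

end CapBound

/-! ### Length, dimension and minimum distance. -/

section Parameters

open Module

variable {p : ℕ} [hp : Fact p.Prime] {V : Type*} [AddCommGroup V] [Module (ZMod p) V] [Fintype V]
  {B : LinearMap.BilinForm (ZMod p) V} {f : V → ZMod p} {s m : ℕ} {x : Fin m → V}

theorem eps_mem (α : V) : eps B f s α = 0 ∨ eps B f s α = 1 ∨ eps B f s α = -1 := by
  unfold eps; split_ifs <;> simp

theorem three_le_of_ne_two (hp2 : p ≠ 2) : 3 ≤ p := by
  have := hp.out.two_le; omega

omit [Fintype V] in
theorem pairwiseIndep_of_transversal (hx : Function.Injective x)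
    (hD : IsScalarTransversal (p := p) (Set.range x) ({v : V | f v = 0} \ {0})) :
    PairwiseIndep (p := p) x :=
  fun _ _ hij _ _ h => hD.pairwise hx (by simp) hij h

omit [Fintype V] in
theorem ne_zero_of_transversal
    (hD : IsScalarTransversal (p := p) (Set.range x) ({v : V | f v = 0} \ {0})) (i : Fin m) :
    x i ≠ 0 := by
  have : x i ∈ {v : V | f v = 0} \ {0} := hD.mem_iff.2 ⟨1, i, by simp⟩
  exact this.2

theorem card_zeros_of_transversal (hf : f 0 = 0) (hx : Function.Injective x)
    (hD : IsScalarTransversal (p := p) (Set.range x) ({v : V | f v = 0} \ {0})) :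
    ((Finset.univ.filter fun v => f v = B 0 v).card : ℤ) = ((p : ℤ) - 1) * m + 1 := by
  have h0 := hD.card_zeros hf hx (fun _ => True) trivial (fun _ _ => Iff.rfl)
  simp only [and_true, Finset.filter_true, Finset.card_univ, Fintype.card_fin] at h0
  simp only [map_zero, LinearMap.zero_apply]
  rw [h0]
  have := hp.out.one_le
  push_cast [Nat.cast_sub this]
  ring

omit [Fintype V] in
theorem card_hyperplane_eq_of_forall {α : V} (h : ∀ i, B α (x i) = 0) :
    (Finset.univ.filter fun i => B α (x i) = 0).card = m := by
  rw [Finset.filter_true_of_mem fun i _ => h i, Finset.card_univ, Fintype.card_fin]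

theorem IsPlateaued.card_eq_bilin_of_even' (hp2 : p ≠ 2) (hf : IsPlateaued B f s)
    (heven : Even (finrank (ZMod p) V + s)) (hpos : 0 < finrank (ZMod p) V) (α : V) :
    ((Finset.univ.filter fun x => f x = B α x).card : ℤ) =
      p ^ (finrank (ZMod p) V - 1) + eps B f s α *
        p ^ ((finrank (ZMod p) V + s) / 2 - 1) *
        (if dual B f s α = 0 then (p : ℤ) - 1 else -1) := by
  have h := hf.card_eq_bilin_of_even hp2 heven α
  have hpz : (p : ℤ) ≠ 0 := Nat.cast_ne_zero.2 hp.out.ne_zero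
  apply mul_left_cancel₀ hpz
  have h1 : (p : ℤ) ^ finrank (ZMod p) V = p * p ^ (finrank (ZMod p) V - 1) := by
    rw [← pow_succ', Nat.sub_add_cancel hpos]
  have h2 : (p : ℤ) ^ ((finrank (ZMod p) V + s) / 2) =
      p * p ^ ((finrank (ZMod p) V + s) / 2 - 1) := by
    rw [← pow_succ', Nat.sub_add_cancel]
    rw [Nat.even_iff] at heven; omega
  rw [h, h1, h2]; ring

/-- If `f` has a non-zero Walsh value at every point and `k = 0`, all signs are `-1`. -/
theorem eps_eq_neg_one_of_card_bPlus_eq_zero (hp2 : p ≠ 2) {α : V} (hα : α ∈ walshSupport B f s)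
    (hk : (bPlus B f s).card = 0) : eps B f s α = -1 := by
  refine (eps_eq_one_or_neg_one hp2 hα).resolve_left fun h => ?_
  rw [eps_eq_one_iff, Finset.card_eq_zero.1 hk] at h
  exact absurd h (Finset.notMem_empty _)

theorem IsPlateaued.mem_walshSupport_of_zero (hB : B.Nondegenerate) (hf : IsPlateaued B f 0)
    (α : V) : α ∈ walshSupport B f 0 := by
  have h := hf.card_walshSupport hB
  rw [Nat.sub_zero, ← card_eq_pow_finrank_zmod (p := p)] at h
  rw [(Finset.card_eq_iff_eq_univ _).1 h]
  exact Finset.mem_univ _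

theorem ClassF.parameters_of_even (hp2 : p ≠ 2) (hB : B.Nondegenerate) (hsymm : B.IsSymm)
    (hf : ClassF B f s) (hx : Function.Injective x)
    (hD : IsScalarTransversal (p := p) (Set.range x) ({v : V | f v = 0} \ {0}))
    (heven : Even (finrank (ZMod p) V + s)) (hs : s + 4 ≤ finrank (ZMod p) V) :
    (m : ℚ) = ((p : ℚ) ^ (finrank (ZMod p) V - 1) +
        (eps B f s 0 : ℚ) * ((p : ℚ) - 1) * (p : ℚ) ^ ((finrank (ZMod p) V + s) / 2 - 1) - 1) /
          ((p : ℚ) - 1) ∧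
    (finrank (ZMod p) (dualCode (definingSetCode B x)) : ℤ) = (m : ℤ) - finrank (ZMod p) V ∧
    ((s = 0 ∧ finrank (ZMod p) V = 4 ∧ (bPlus B f s).card = 0) →
      HasMinDist (dualCode (definingSetCode B x)) 4) ∧
    (¬ (s = 0 ∧ finrank (ZMod p) V = 4 ∧ (bPlus B f s).card = 0) →
      HasMinDist (dualCode (definingSetCode B x)) 3) := by
  classical
  set n := finrank (ZMod p) V with hn
  have hp3 : (3 : ℤ) ≤ p := by exact_mod_cast three_le_of_ne_two hp2
  have hpair := pairwiseIndep_of_transversal hx hD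
  have hne := ne_zero_of_transversal hD
  obtain ⟨h0S, h0dual⟩ := hf.zero_mem hp2 hB hsymm
  have hε0 := eps_eq_one_or_neg_one hp2 h0S
  have hM := hf.plateaued.card_eq_bilin_of_even' hp2 heven (by omega)
  have hcount : ((p : ℤ) - 1) * m + 1 =
      p ^ (n - 1) + eps B f s 0 * p ^ ((n + s) / 2 - 1) * (p - 1) := by
    rw [← card_zeros_of_transversal (B := B) hf.map_zero hx hD, hM 0, if_pos h0dual]
  have hhyp : ∀ α : V, α ≠ 0 → (p : ℤ) * (Finset.univ.filter fun i => B α (x i) = 0).card =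
      m - 1 + eps B f s α * p ^ ((n + s) / 2 - 1) *
        (if dual B f s α = 0 then (p : ℤ) - 1 else -1) := by
    intro α hα
    rw [hf.card_transversal_hyperplane hp2 hB hsymm hx hD hα, hM α]; ring
  have hq : 0 < (p : ℤ) ^ ((n + s) / 2 - 1) := by positivity
  refine ⟨?_, ?_, ?_, ?_⟩
  · have hp1 : (p : ℚ) - 1 ≠ 0 := by
      have : (3 : ℚ) ≤ p := by exact_mod_cast hp3
      linarith
    rw [eq_div_iff hp1]
    have : ((p : ℚ) - 1) * m + 1 =
      p ^ (n - 1) + eps B f s 0 * p ^ ((n + s) / 2 - 1) * (p - 1) := by exact_mod_cast hcount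
    linarith
  · refine finrank_dualCode hB fun α hα => ?_
    by_contra hα0
    have h1 := hhyp α hα0
    rw [card_hyperplane_eq_of_forall hα] at h1
    set Q := (p : ℤ) ^ ((n + s) / 2 - 1) with hQ
    have h2 : eps B f s α * Q * (if dual B f s α = 0 then (p : ℤ) - 1 else -1) ≤ Q * (p - 1) := by
      rcases eps_mem (B := B) (f := f) (s := s) α with h | h | h <;> rw [h] <;> split_ifs <;>
        nlinarith
    have h3 : -(Q * (p - 1)) ≤ eps B f s 0 * Q * (p - 1) := by
      rcases hε0 with h | h <;> rw [h] <;> nlinarith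
    -- This is where `s ≤ n - 4` enters. All points on one hyperplane would give `p ^ (n - 1) ≤ 2 *
    -- Q * (p - 1)`, which is less than `Q * p ^ 2`.
    have h4 : Q * p ^ 2 ≤ (p : ℤ) ^ (n - 1) := by
      rw [hQ, ← pow_add]
      exact pow_le_pow_right₀ (by linarith) (by omega)
    have h5 : 0 < Q * ((p : ℤ) ^ 2 - 2 * p + 2) := mul_pos hq (by nlinarith)
    linarith
  · rintro ⟨rfl, hn4, hk⟩
    have hS := hf.plateaued.mem_walshSupport_of_zero hB
    have hneg : ∀ α, eps B f 0 α = -1 := fun α =>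
      eps_eq_neg_one_of_card_bPlus_eq_zero hp2 (hS α) hk
    rw [hn4] at hcount hhyp
    norm_num at hcount hhyp
    have hm : (m : ℤ) = p ^ 2 + 1 := by
      apply mul_left_cancel₀ (show (p : ℤ) - 1 ≠ 0 by linarith)
      rw [hneg] at hcount
      linarith
    have hm' : m = p ^ 2 + 1 := by exact_mod_cast hm
    have hplane : ∀ α : V, α ≠ 0 → 2 ≤ (Finset.univ.filter fun i => B α (x i) = 0).card →
        (Finset.univ.filter fun i => B α (x i) = 0).card = p + 1 := by
      intro α hα h2
      have h1 := hhyp α hα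
      rw [hneg, hm] at h1
      have hpz : (p : ℤ) ≠ 0 := by linarith
      split_ifs at h1
      · have : (((Finset.univ.filter fun i => B α (x i) = 0).card : ℕ) : ℤ) = 1 := by
          apply mul_left_cancel₀ hpz
          rw [h1]; ring
        omega
      · have : (((Finset.univ.filter fun i => B α (x i) = 0).card : ℕ) : ℤ) = p + 1 := by
          apply mul_left_cancel₀ hpz
          rw [h1]; ring
        exact_mod_cast this
    have hcap : IsCap (p := p) x := hpair.isCap_of_finrank_eq_four hB hsymm hn4 hm' hplane
    have hm2 : 1 < m := by
      have : 0 < p ^ 2 := pow_pos hp.out.pos 2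
      omega
    -- A plane through two of the points has `p + 1 ≥ 4` of them, which supplies the four coplanar
    -- points.
    obtain ⟨α, hα, hαx⟩ := exists_ne_zero_bilin_eq_zero B
      ![x ⟨0, by omega⟩, x ⟨1, hm2⟩] (by omega)
    have h2 : 2 ≤ (Finset.univ.filter fun i => B α (x i) = 0).card := by
      have hsub : ({⟨0, by omega⟩, ⟨1, hm2⟩} : Finset (Fin m)) ⊆
          Finset.univ.filter fun i => B α (x i) = 0 := by
        intro i hi
        simp only [Finset.mem_insert, Finset.mem_singleton] at hi
        have h0 := hαx 0
        have h1 := hαx 1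
        rcases hi with rfl | rfl
        · exact Finset.mem_filter.2 ⟨Finset.mem_univ _, h0⟩
        · exact Finset.mem_filter.2 ⟨Finset.mem_univ _, h1⟩
      have := Finset.card_le_card hsub
      rwa [Finset.card_pair (by simp)] at this
    have hker := finrank_ker_bilin hB hα
    refine hasMinDist_four hB hpair hne hcap
      (Finset.univ.filter fun i => B α (x i) = 0) (LinearMap.ker (B α)) (by omega) ?_
      fun i hi => (Finset.mem_filter.1 hi).2
    rw [hplane α hα h2]
    have := three_le_of_ne_two hp2
    omega
  · intro hnot
    refine hasMinDist_three hB hpair hne fun hcap => hnot ?_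
    have hcard := hcap.card_le hp2 hpair
    have hcard' : (m : ℤ) ≤ p ^ (n - 2) + 1 := by exact_mod_cast hcard
    obtain ⟨k, hk⟩ : ∃ k, n = k + 4 := ⟨n - 4, by omega⟩
    have e1 : (p : ℤ) ^ (n - 1) = p * (p * p ^ (k + 1)) := by
      rw [← pow_succ', ← pow_succ']; congr 1; omega
    have e2 : (p : ℤ) ^ (n - 2) = p * p ^ (k + 1) := by
      rw [← pow_succ']; congr 1; omega
    set R := (p : ℤ) ^ (k + 1) with hR
    set Q := (p : ℤ) ^ ((n + s) / 2 - 1) with hQ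
    have hQR : Q ≤ R := pow_le_pow_right₀ (by linarith) (by omega)
    -- With `R = p ^ (n - 3)`, inserting `hcount` in the cap bound gives `p * R + ε_0 * Q * (p - 1)
    -- ≤ p`. As `R ≥ p` this excludes `ε_0 = 1`; for `ε_0 = -1`, `Q ≤ R` yields `R ≤ p`, hence `n =
    -- 4` and `s = 0`.
    have hmul : ((p : ℤ) - 1) * m ≤ (p - 1) * (p * R + 1) :=
      mul_le_mul_of_nonneg_left (e2 ▸ hcard') (by linarith)
    rw [e1] at hcount
    have hε : eps B f s 0 = -1 := by
      refine hε0.resolve_left fun h => ?_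
      rw [h] at hcount
      have : (p : ℤ) ≤ R := by
        simpa [hR] using pow_le_pow_right₀ (show (1 : ℤ) ≤ p by linarith) (show 1 ≤ k + 1 by omega)
      nlinarith
    rw [hε] at hcount
    have hRp : R ≤ p := by nlinarith
    have hk0 : k = 0 := by
      by_contra hk0
      have : (p : ℤ) ^ 2 ≤ R := pow_le_pow_right₀ (by linarith) (by omega)
      nlinarith
    subst hk0
    have hs0 : s = 0 := by omega
    subst hs0
    have hn4 : n = 4 := hk
    refine ⟨rfl, hn4, ?_⟩
    have hQp : Q = p := by rw [hQ, hn4]; norm_num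
    have hRp' : R = p := by rw [hR]; norm_num
    rw [hQp, hRp'] at hcount
    have hm : (m : ℤ) = p ^ 2 + 1 := by
      apply mul_left_cancel₀ (show (p : ℤ) - 1 ≠ 0 by linarith)
      linarith
    have hm' : m = p ^ 2 + 1 := by exact_mod_cast hm
    rw [Finset.card_eq_zero, Finset.eq_empty_iff_forall_notMem]
    intro α hα
    rw [← eps_eq_one_iff] at hα
    have hα0 : α ≠ 0 := by
      rintro rfl
      rw [hε] at hα
      norm_num at hα
    have h1 := hhyp α hα0
    rw [hα, hm, hQp] at h1
    have hpz : (p : ℤ) ≠ 0 := by linarith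
    have hplane := hcap.card_hyperplane_eq hp2 hpair hB hn4 hm' hα0
    -- A sign `ε_α = 1` gives a plane section of `2 * p - 1` or `p - 1` points. For `p ≥ 3` both are
    -- at least 2 and neither equals `p + 1`, as an ovoid would require.
    have hval : (((Finset.univ.filter fun i => B α (x i) = 0).card : ℕ) : ℤ) = 2 * p - 1 ∨
        (((Finset.univ.filter fun i => B α (x i) = 0).card : ℕ) : ℤ) = p - 1 := by
      split_ifs at h1
      · left
        apply mul_left_cancel₀ hpz
        rw [h1]; ring
      · right
        apply mul_left_cancel₀ hpz
        rw [h1]; ring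
    have := hplane (by omega)
    omega

theorem ClassF.parameters_of_odd (hp2 : p ≠ 2) (hB : B.Nondegenerate) (hsymm : B.IsSymm)
    (hf : ClassF B f s) (hx : Function.Injective x)
    (hD : IsScalarTransversal (p := p) (Set.range x) ({v : V | f v = 0} \ {0}))
    (hodd : Odd (finrank (ZMod p) V + s)) (hs : s + 3 ≤ finrank (ZMod p) V) :
    (m : ℚ) = ((p : ℚ) ^ (finrank (ZMod p) V - 1) - 1) / ((p : ℚ) - 1) ∧
    (finrank (ZMod p) (dualCode (definingSetCode B x)) : ℤ) = (m : ℤ) - finrank (ZMod p) V ∧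
    ((s = 0 ∧ finrank (ZMod p) V = 3) → HasMinDist (dualCode (definingSetCode B x)) 4) ∧
    (¬ (s = 0 ∧ finrank (ZMod p) V = 3) → HasMinDist (dualCode (definingSetCode B x)) 3) := by
  classical
  set n := finrank (ZMod p) V with hn
  have hp3 : (3 : ℤ) ≤ p := by exact_mod_cast three_le_of_ne_two hp2
  have hpair := pairwiseIndep_of_transversal hx hD
  have hne := ne_zero_of_transversal hD
  obtain ⟨h0S, h0dual⟩ := hf.zero_mem hp2 hB hsymm
  have hM := hf.plateaued.card_eq_bilin_of_odd hp2 (by omega) hodd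
  have hcount : ((p : ℤ) - 1) * m + 1 = p ^ (n - 1) := by
    obtain ⟨r, -, hr, h⟩ := hM 0
    rw [← card_zeros_of_transversal (B := B) hf.map_zero hx hD, h, hr h0dual]; ring
  have hhyp : ∀ α : V, α ≠ 0 → ∃ r : ℤ, r ≤ 1 ∧
      (p : ℤ) * (Finset.univ.filter fun i => B α (x i) = 0).card =
      m - 1 + r * p ^ ((n + s) / 2) := by
    intro α hα
    obtain ⟨r, hr, -, h⟩ := hM α
    refine ⟨r, by omega, ?_⟩
    rw [hf.card_transversal_hyperplane hp2 hB hsymm hx hD hα, h]; ring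
  have hmod := Nat.odd_iff.1 hodd
  refine ⟨?_, ?_, ?_, ?_⟩
  · have hp1 : (p : ℚ) - 1 ≠ 0 := by
      have : (3 : ℚ) ≤ p := by exact_mod_cast hp3
      linarith
    rw [eq_div_iff hp1]
    have : ((p : ℚ) - 1) * m + 1 = p ^ (n - 1) := by exact_mod_cast hcount
    linarith
  · refine finrank_dualCode hB fun α hα => ?_
    by_contra hα0
    obtain ⟨r, hr, h1⟩ := hhyp α hα0
    rw [card_hyperplane_eq_of_forall hα] at h1
    -- If all points were on `α^⊥`, then `(p - 1) * m + 1 = r * p ^ ((n + s) / 2)` with `r ≤ 1`,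
    -- whereas it equals `p ^ (n - 1)`.
    have h2 : (p : ℤ) ^ ((n + s) / 2) < p ^ (n - 1) :=
      pow_lt_pow_right₀ (by linarith) (by omega)
    have h3 : 0 < (p : ℤ) ^ ((n + s) / 2) := by positivity
    nlinarith
  · rintro ⟨rfl, hn3⟩
    rw [hn3] at hcount hhyp
    norm_num at hcount hhyp
    have hm : (m : ℤ) = p + 1 := by
      apply mul_left_cancel₀ (show (p : ℤ) - 1 ≠ 0 by linarith)
      linarith
    have hcap : IsCap (p := p) x := by
      refine hpair.isCap_of_finrank_eq_three (B := B) hn3 fun α hα => ?_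
      obtain ⟨r, hr, h1⟩ := hhyp α hα
      rw [hm] at h1
      have : (((Finset.univ.filter fun i => B α (x i) = 0).card : ℕ) : ℤ) = 1 + r := by
        apply mul_left_cancel₀ (show (p : ℤ) ≠ 0 by linarith)
        rw [h1]; ring
      omega
    -- The ambient space already has dimension 3, and there are `m = p + 1 ≥ 4` points.
    refine hasMinDist_four hB hpair hne hcap Finset.univ ⊤ (by rw [finrank_top]; omega) ?_
      fun i _ => Submodule.mem_top
    rw [Finset.card_univ, Fintype.card_fin]
    omega
  · intro hnot
    refine hasMinDist_three hB hpair hne fun hcap => hnot ?_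
    have hcard := hcap.card_le hp2 hpair
    have hcard' : (m : ℤ) ≤ p ^ (n - 2) + 1 := by exact_mod_cast hcard
    by_contra hns
    have hn4 : 4 ≤ n := by omega
    have e1 : (p : ℤ) ^ (n - 1) = p * p ^ (n - 2) := by
      rw [← pow_succ']; congr 1; omega
    have e2 : (p : ℤ) ^ 2 ≤ p ^ (n - 2) := pow_le_pow_right₀ (by linarith) (by omega)
    -- The cap bound would give `p ^ (n - 2) ≤ p`, impossible for `n ≥ 4`.
    have hmul : ((p : ℤ) - 1) * m ≤ (p - 1) * (p ^ (n - 2) + 1) :=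
      mul_le_mul_of_nonneg_left hcard' (by linarith)
    nlinarith

end Parameters

end PlateauedCode

theorem proposition6 (p : ℕ) [Fact p.Prime] (hp : p ≠ 2)
    {V : Type*} [AddCommGroup V] [Module (ZMod p) V] [Fintype V]
    (B : LinearMap.BilinForm (ZMod p) V) (hBsymm : B.IsSymm) (hBnondeg : B.Nondegenerate)
    (n s : ℕ) (hn : Module.finrank (ZMod p) V = n)
    (f : V → ZMod p) (hf : PlateauedCode.ClassF B f s)
    (m : ℕ) (x : Fin m → V) (hx : Function.Injective x)
    (hD : PlateauedCode.IsScalarTransversal (p := p) (Set.range x) ({v : V | f v = 0} \ {0})) :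
    (Even (n + s) → s + 4 ≤ n →
      (m : ℚ) = ((p : ℚ) ^ (n - 1) +
          (PlateauedCode.eps B f s 0 : ℚ) * ((p : ℚ) - 1) * (p : ℚ) ^ ((n + s) / 2 - 1) - 1) /
            ((p : ℚ) - 1) ∧
      (Module.finrank (ZMod p)
          (PlateauedCode.dualCode (PlateauedCode.definingSetCode B x)) : ℤ) = (m : ℤ) - n ∧
      ((s = 0 ∧ n = 4 ∧ (PlateauedCode.bPlus B f s).card = 0) →
        PlateauedCode.HasMinDist
          (PlateauedCode.dualCode (PlateauedCode.definingSetCode B x)) 4) ∧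
      (¬ (s = 0 ∧ n = 4 ∧ (PlateauedCode.bPlus B f s).card = 0) →
        PlateauedCode.HasMinDist
          (PlateauedCode.dualCode (PlateauedCode.definingSetCode B x)) 3)) ∧
    (Odd (n + s) → s + 3 ≤ n →
      (m : ℚ) = ((p : ℚ) ^ (n - 1) - 1) / ((p : ℚ) - 1) ∧
      (Module.finrank (ZMod p)
          (PlateauedCode.dualCode (PlateauedCode.definingSetCode B x)) : ℤ) = (m : ℤ) - n ∧
      ((s = 0 ∧ n = 3) →
        PlateauedCode.HasMinDist
          (PlateauedCode.dualCode (PlateauedCode.definingSetCode B x)) 4) ∧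
      (¬ (s = 0 ∧ n = 3) →
        PlateauedCode.HasMinDist
          (PlateauedCode.dualCode (PlateauedCode.definingSetCode B x)) 3)) := by
  subst hn
  exact ⟨fun h hs => hf.parameters_of_even hp hBnondeg hBsymm hx hD h hs,
    fun h hs => hf.parameters_of_odd hp hBnondeg hBsymm hx hD h hs⟩
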